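/- Let $p$ be a prime and let $L$ be a $3$-dimensional $\mathbb{Z}_p$-Lie algebra or, more generally, a free $\mathbb{Z}_p$-module of rank $3$ with an antisymmetric $\mathbb{Z}_p$-bilinear product $[\,\cdot,\cdot\,]$ (the Jacobi identity is not needed). For a $\mathbb{Z}_p$-algebra $M$ of finite rank put $\zeta_M(s)=\sum_{H\le M}|M:H|^{-s}$, the sum being over the subalgebras $H$ of finite index in $M$; put $\zeta_p(s)=(1-p^{-s})^{-1}$; and for $f\in\mathbb{Z}_p[x_1,x_2,x_3]$ let $Z_f(s)=\int_{\mathbb{Z}_p^3}|f(\mathbf{x})|_p^s\,d\mu$ be Igusa's local zeta function, where $\mu$ is the normalised additive Haar measure on $\mathbb{Z}_p^3$. For a $\mathbb{Z}_p$-basis $e=(e_1,e_2,e_3)$ of $L$ with structure constants $[e_i,e_j]=\sum_k\lambda_{ij}^k e_k$, put $\mathrm{L}_{ij}(\mathbf{x})=\sum_k\lambda_{ij}^k x_k$ and $$f_e(\mathbf{x})=\mathrm{L}_{23}(\mathbf{x})x_1-\mathrm{L}_{13}(\mathbf{x})x_2+\mathrm{L}_{12}(\mathbf{x})x_3 .$$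 Call two ternary quadratic forms $f,f'$ over $\mathbb{Z}_p$ equivalent if there are a $3\times 3$ matrix $A$ over $\mathbb{Z}_p$ and $P\in\mathrm{GL}_3(\mathbb{Z}_p)$ with $f(\mathbf{x})=\mathbf{x}A\mathbf{x}^{\mathrm t}$ and $f'(\mathbf{x})=\mathbf{x}A'\mathbf{x}^{\mathrm t}$, where $A'=(\det P)P^{-1}A(P^{-1})^{\mathrm t}$. Then there is a ternary quadratic form $f(\mathbf{x})\in\mathbb{Z}_p[x_1,x_2,x_3]$ (possibly zero), canonically attached to $L$ up to equivalence in the sense that the forms $f_e$, for $e$ running over all $\mathbb{Z}_p$-bases of $L$, are exactly the forms equivalent to $f$, such that for every integer $i\ge 0$ and every complex $s$ with $\operatorname{Re}(s)>2$ the series $\zeta_{p^iL}(s)$ and $\zeta_{\mathbb{Z}_p^3}(s)$ converge absolutely, the integral $Z_f(s-2)$ converges absolutely, and $$\zeta_{p^iL}(s)=\zeta_{\mathbb{Z}_p^3}(s)-Z_f(s-2)\,\zeta_p(2s-2)\,\zeta_p(s-2)\,p^{(2-s)(i+1)}(1-p^{-1})^{-1},$$ where $\zeta_{\mathbb{Z}_p^3}(s)=\zeta_p(s)\zeta_p(s-1)\zeta_p(s-2)$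 is the zeta function of the abelian Lie algebra $\mathbb{Z}_p^3$. -/

import Mathlib

open scoped Pointwise

/-- The Borel `σ`-algebra on the `p`-adic integers. -/
noncomputable instance padicIntMeasurableSpace (p : ℕ) [Fact p.Prime] :
    MeasurableSpace ℤ_[p] := borel ℤ_[p]

instance padicIntBorelSpace (p : ℕ) [Fact p.Prime] : BorelSpace ℤ_[p] := ⟨rfl⟩

/-- The normalised additive Haar measure on the `p`-adic integers (total mass `1`).
The volume on `Fin 3 → ℤ_[p]` is then the normalised Haar measure, as a product measure. -/
noncomputable instance padicIntMeasureSpace (p : ℕ) [Fact p.Prime] :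
    MeasureTheory.MeasureSpace ℤ_[p] where
  volume := MeasureTheory.Measure.addHaarMeasure (⊤ : TopologicalSpace.PositiveCompacts ℤ_[p])

namespace PadicLieZeta

variable {p : ℕ} [Fact p.Prime]
variable {L : Type*} [AddCommGroup L] [Module ℤ_[p] L]

/-- The subalgebras `H` of finite index in the subalgebra `M` of the `ℤ_p`-algebra `L` whose
product is `β`: the `ℤ_p`-submodules of `M` that are closed under `β` and have finite index. -/
def FiniteIndexSubalgebra (β : L →ₗ[ℤ_[p]] L →ₗ[ℤ_[p]] L) (M : Submodule ℤ_[p] L) : Type _ :=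
  {H : Submodule ℤ_[p] L // H ≤ M ∧ (∀ x ∈ H, ∀ y ∈ H, β x y ∈ H) ∧
    H.toAddSubgroup.relIndex M.toAddSubgroup ≠ 0}

/-- The summand `|M : H|^(-s)`. -/
noncomputable def zetaTerm (β : L →ₗ[ℤ_[p]] L →ₗ[ℤ_[p]] L) (M : Submodule ℤ_[p] L) (s : ℂ)
    (H : FiniteIndexSubalgebra β M) : ℂ :=
  ((H.1.toAddSubgroup.relIndex M.toAddSubgroup : ℕ) : ℂ) ^ (-s)

/-- The subalgebra zeta function `∑_{H ≤ M} |M : H|^(-s)` of the algebra `M`. -/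
noncomputable def subalgebraZeta (β : L →ₗ[ℤ_[p]] L →ₗ[ℤ_[p]] L) (M : Submodule ℤ_[p] L)
    (s : ℂ) : ℂ :=
  ∑' H : FiniteIndexSubalgebra β M, zetaTerm β M s H

/-- The product of the abelian Lie algebra `ℤ_p³`. -/
noncomputable def abelianBracket (p : ℕ) [Fact p.Prime] :
    (Fin 3 → ℤ_[p]) →ₗ[ℤ_[p]] (Fin 3 → ℤ_[p]) →ₗ[ℤ_[p]] (Fin 3 → ℤ_[p]) := 0

/-- The local Riemann zeta function `ζ_p(s) = (1 - p^(-s))⁻¹`. -/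
noncomputable def localZeta (p : ℕ) (s : ℂ) : ℂ := (1 - (p : ℂ) ^ (-s))⁻¹

/-- The integrand `|f(x)|_p^s`. -/
noncomputable def igusaIntegrand (f : MvPolynomial (Fin 3) ℤ_[p]) (s : ℂ)
    (x : Fin 3 → ℤ_[p]) : ℂ :=
  ((‖MvPolynomial.eval x f‖ : ℝ) : ℂ) ^ s

/-- Igusa's local zeta function `Z_f(s) = ∫_{ℤ_p³} |f(x)|_p^s dμ`. -/
noncomputable def igusaZeta (f : MvPolynomial (Fin 3) ℤ_[p]) (s : ℂ) : ℂ :=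
  ∫ x : Fin 3 → ℤ_[p], igusaIntegrand f s x

/-- The structure constant `λ_{ij}^k`: the `e_k`-coordinate of the product of `e_i` and `e_j`. -/
noncomputable def structureConstant (β : L →ₗ[ℤ_[p]] L →ₗ[ℤ_[p]] L)
    (e : Module.Basis (Fin 3) ℤ_[p] L) (i j k : Fin 3) : ℤ_[p] :=
  e.repr (β (e i) (e j)) k

/-- The linear form `L_{ij}(x) = ∑_k λ_{ij}^k x_k`. -/
noncomputable def structureLinearForm (β : L →ₗ[ℤ_[p]] L →ₗ[ℤ_[p]] L)
    (e : Module.Basis (Fin 3) ℤ_[p] L) (i j : Fin 3) : MvPolynomial (Fin 3) ℤ_[p] :=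
  ∑ k, MvPolynomial.C (structureConstant β e i j k) * MvPolynomial.X k

/-- The ternary quadratic form `L_{23}(x) x_1 - L_{13}(x) x_2 + L_{12}(x) x_3`
(the indices `1, 2, 3` are `0, 1, 2` here). -/
noncomputable def structureForm (β : L →ₗ[ℤ_[p]] L →ₗ[ℤ_[p]] L)
    (e : Module.Basis (Fin 3) ℤ_[p] L) : MvPolynomial (Fin 3) ℤ_[p] :=
  structureLinearForm β e 1 2 * MvPolynomial.X 0
    - structureLinearForm β e 0 2 * MvPolynomial.X 1
    + structureLinearForm β e 0 1 * MvPolynomial.X 2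

/-- The ternary quadratic form `x A xᵗ` of a (not necessarily symmetric) matrix `A`. -/
noncomputable def matrixForm (A : Matrix (Fin 3) (Fin 3) ℤ_[p]) : MvPolynomial (Fin 3) ℤ_[p] :=
  ∑ i, ∑ j, MvPolynomial.C (A i j) * MvPolynomial.X i * MvPolynomial.X j

/-- Two ternary quadratic forms `f = x A xᵗ` and `g = x A' xᵗ` are equivalent if
`A' = (det P) P⁻¹ A (P⁻¹)ᵗ` for some `P ∈ GL₃(ℤ_p)`. -/
def FormEquivalent (f g : MvPolynomial (Fin 3) ℤ_[p]) : Prop :=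
  ∃ (A P : Matrix (Fin 3) (Fin 3) ℤ_[p]), IsUnit P.det ∧ f = matrixForm A ∧
    g = matrixForm (P.det • (P⁻¹ * A * (P⁻¹).transpose))

end PadicLieZeta

/-! It suffices to count the lattices of each index `p^d` in `L` that are not subalgebras; all
lattices together give the abelian zeta function. A lattice `Λ` of index `p^d` is tested against the
functionals `x` with `x(Λ) ⊆ p^d`. In a Smith basis with exponents `n 0 ≤ n 1 ≤ n 2`, the structure
form of such a functional is modulo `p^d` a multiple of a single square, and closure of `Λ` is one
divisibility with the same coefficient (`formValue_diagonal`, `closed_iff_of_diagonal`). Hence the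
functionals with `p^d ∤ p^m f(x)` fill a box minus a smaller box. The volume for `m = 0` minus `p⁻¹`
times the volume for `m = 2` is then `0` for a subalgebra and `(1 - p⁻¹) p^(-2d)` otherwise, no
matter how badly closure fails (`badSet_volume_identity`).

Summing over `Λ` and exchanging the order (`sum_volume_badSet`) turns the count into an integral
over `x`. If `x` has content exactly `p^c`, `c < d`, the lattices seen by `x` are the sublattices of
index `p^c` in a lattice of index `p^(d-c)`, so their number depends on `c` alone. As `f` is
quadratic, removing the content leaves only the volumes of `{p^k ∤ f}`, whose generating series is
Igusa's integral (`mul_igusaZeta`).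

In generating functions (`hasSum_card_not_closed`) the lattice count contributes three Euler factors
in `t²`, `t = p^(-s)`; the shifts by content and by `m` cancel two of them, and the survivor is
`ζ_p(2s-2)`. Finally `p^i L` is `L` with product `p^i β`, which multiplies `f` by `p^i`. Canonicity
holds because the structure form is alternating trilinear in the basis (`formValue_change`). -/

namespace PadicLieZeta

open MeasureTheory

/-! ### Indices of `ℤ_p`-submodules. -/

section LatticeIndex

variable {p : ℕ} [Fact p.Prime]
variable {M N : Type*} [AddCommGroup M] [Module ℤ_[p] M] [AddCommGroup N] [Module ℤ_[p] N]

/-- The index of a `ℤ_p`-submodule, as an additive subgroup (`0` if it is infinite). -/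
noncomputable def latticeIndex (Λ : Submodule ℤ_[p] M) : ℕ := Λ.toAddSubgroup.index

theorem latticeIndex_smul_mem (Λ : Submodule ℤ_[p] M) (x : M) :
    ((latticeIndex Λ : ℕ) : ℤ_[p]) • x ∈ Λ := by
  rw [Nat.cast_smul_eq_nsmul]
  exact Λ.toAddSubgroup.nsmul_index_mem x

theorem isUnit_natCast_of_prime_ne {q : ℕ} (hq : q.Prime) (h : q ≠ p) :
    IsUnit ((q : ℕ) : ℤ_[p]) := by
  rw [PadicInt.isUnit_iff, PadicInt.norm_natCast_eq_one_iff]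
  exact (Nat.coprime_primes (Fact.out) hq).2 (Ne.symm h)

/-- A prime `q ≠ p` is a unit of `ℤ_p`, so the quotient has no `q`-torsion, and Cauchy's theorem
excludes `q` from the index. -/
theorem exists_latticeIndex_eq_pow (Λ : Submodule ℤ_[p] M) (h : latticeIndex Λ ≠ 0) :
    ∃ n : ℕ, latticeIndex Λ = p ^ n := by
  refine ⟨_, Nat.eq_prime_pow_of_unique_prime_dvd h ?_⟩
  intro q hq hdvd
  by_contra hne
  have : Λ.toAddSubgroup.FiniteIndex := ⟨h⟩
  have := Fact.mk hq
  obtain ⟨x, hx⟩ := exists_prime_addOrderOf_dvd_card' (G := M ⧸ Λ.toAddSubgroup) q hdvd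
  obtain ⟨u, hu⟩ := isUnit_natCast_of_prime_ne (p := p) hq hne
  obtain ⟨y, rfl⟩ := QuotientAddGroup.mk_surjective x
  have h0 : q • (QuotientAddGroup.mk y : M ⧸ Λ.toAddSubgroup) = 0 := by
    rw [← hx]; exact addOrderOf_nsmul_eq_zero _
  rw [← QuotientAddGroup.mk_nsmul, QuotientAddGroup.eq_zero_iff] at h0
  have h1 : ((q : ℕ) : ℤ_[p]) • y ∈ Λ := by rw [Nat.cast_smul_eq_nsmul]; exact h0
  have h2 : y ∈ Λ := by
    have := Λ.smul_mem ((u⁻¹ : ℤ_[p]ˣ) : ℤ_[p]) h1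
    rwa [← hu, smul_smul, Units.inv_mul, one_smul] at this
  have h3 : (QuotientAddGroup.mk y : M ⧸ Λ.toAddSubgroup) = 0 :=
    (QuotientAddGroup.eq_zero_iff _).2 h2
  rw [h3, addOrderOf_zero] at hx
  exact hq.one_lt.ne hx

/-- Multiplication by the index embeds `M` into `Λ`. -/
theorem finrank_eq_of_latticeIndex_ne_zero [Module.Free ℤ_[p] M] [Module.Finite ℤ_[p] M]
    (Λ : Submodule ℤ_[p] M) (h : latticeIndex Λ ≠ 0) :
    Module.finrank ℤ_[p] Λ = Module.finrank ℤ_[p] M := by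
  refine le_antisymm (Submodule.finrank_le Λ) ?_
  let φ : M →ₗ[ℤ_[p]] Λ :=
    (((latticeIndex Λ : ℕ) : ℤ_[p]) • (LinearMap.id : M →ₗ[ℤ_[p]] M)).codRestrict Λ
      (fun x => by simpa using latticeIndex_smul_mem Λ x)
  refine LinearMap.finrank_le_finrank_of_injective (f := φ) ?_
  intro x y hxy
  have h1 : ((latticeIndex Λ : ℕ) : ℤ_[p]) • x = ((latticeIndex Λ : ℕ) : ℤ_[p]) • y :=
    congrArg Subtype.val hxy
  exact smul_right_injective M (r := ((latticeIndex Λ : ℕ) : ℤ_[p])) (by exact_mod_cast h) h1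

theorem latticeIndex_map_equiv (e : M ≃ₗ[ℤ_[p]] N) (Λ : Submodule ℤ_[p] M) :
    latticeIndex (Λ.map (e : M →ₗ[ℤ_[p]] N)) = latticeIndex Λ := by
  exact AddSubgroup.index_map_equiv Λ.toAddSubgroup e.toAddEquiv

theorem latticeIndex_prod (Λ : Submodule ℤ_[p] (M × N)) :
    latticeIndex Λ = latticeIndex (Λ.map (LinearMap.fst ℤ_[p] M N)) *
      latticeIndex (Λ.comap (LinearMap.inr ℤ_[p] M N)) := by
  set H := Λ.toAddSubgroup with hH
  set f := AddMonoidHom.fst M N with hf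
  have hsurj : f.range = ⊤ := AddMonoidHom.range_eq_top.2 Prod.fst_surjective
  have h1 : (H.map f).index = (H ⊔ f.ker).index := by
    rw [AddSubgroup.index_map, hsurj, AddSubgroup.index_top, mul_one]
  have h2 : (H.comap (AddMonoidHom.inr M N)).index = H.relIndex f.ker := by
    rw [AddSubgroup.index_comap]
    congr 1
    ext ⟨a, b⟩
    simp only [hf, AddMonoidHom.mem_ker, AddMonoidHom.mem_range, AddMonoidHom.inr_apply,
      AddMonoidHom.coe_fst, Prod.mk.injEq]
    exact ⟨fun ⟨_, h, _⟩ => h.symm, fun h => ⟨b, h.symm, rfl⟩⟩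
  have h3 : H.relIndex (H ⊔ f.ker) * (H ⊔ f.ker).index = H.index :=
    AddSubgroup.relIndex_mul_index le_sup_left
  rw [sup_comm, AddSubgroup.relIndex_sup_right] at h3
  change H.index = (H.map f).index * (H.comap (AddMonoidHom.inr M N)).index
  rw [h1, h2, mul_comm, sup_comm, h3]

theorem latticeIndex_span_pow (k : ℕ) :
    latticeIndex (Ideal.span {(p : ℤ_[p]) ^ k} : Submodule ℤ_[p] ℤ_[p]) = p ^ k := by
  have h := AddSubgroup.index_ker (PadicInt.toZModPow (p := p) k).toAddMonoidHom
  have hr : (PadicInt.toZModPow (p := p) k).toAddMonoidHom.range = ⊤ :=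
    AddMonoidHom.range_eq_top.2 (ZMod.ringHom_surjective _)
  rw [hr, Nat.card_congr AddSubgroup.topEquiv.toEquiv, Nat.card_zmod] at h
  rw [← h, latticeIndex]
  congr 1
  ext x
  have := PadicInt.ker_toZModPow (p := p) k
  rw [← this]
  rfl

theorem eq_span_pow_of_latticeIndex {I : Submodule ℤ_[p] ℤ_[p]} {k : ℕ}
    (h : latticeIndex I = p ^ k) : I = Ideal.span {(p : ℤ_[p]) ^ k} := by
  have hp : p.Prime := Fact.out
  have hne : I ≠ ⊥ := by
    rintro rfl
    have := latticeIndex_smul_mem (⊥ : Submodule ℤ_[p] ℤ_[p]) 1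
    rw [h] at this
    simp [hp.ne_zero] at this
  obtain ⟨n, rfl⟩ := PadicInt.ideal_eq_span_pow_p hne
  rw [latticeIndex_span_pow] at h
  rw [Nat.pow_right_injective hp.two_le h]

end LatticeIndex

/-! ### Counting lattices of given index by glueing on one coordinate at a time. -/

section LatticeCount

variable {p : ℕ} [Fact p.Prime]
variable {M N : Type*} [AddCommGroup M] [Module ℤ_[p] M] [AddCommGroup N] [Module ℤ_[p] N]

/-- The submodule of `M × R` glued from `Λ ≤ M` along a homomorphism `h : Λ → R ⧸ I`. -/
def gluedLattice (Λ : Submodule ℤ_[p] M) (I : Submodule ℤ_[p] ℤ_[p])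
    (h : Λ →ₗ[ℤ_[p]] (ℤ_[p] ⧸ I)) : Submodule ℤ_[p] (M × ℤ_[p]) where
  carrier := {x | ∃ hx : x.1 ∈ Λ, h ⟨x.1, hx⟩ = I.mkQ x.2}
  zero_mem' := ⟨Λ.zero_mem, by
    have : (⟨(0 : M × ℤ_[p]).1, Λ.zero_mem⟩ : Λ) = 0 := rfl
    rw [this]; simp⟩
  add_mem' := by
    rintro x y ⟨hx, hx'⟩ ⟨hy, hy'⟩
    refine ⟨Λ.add_mem hx hy, ?_⟩
    have : (⟨(x + y).1, Λ.add_mem hx hy⟩ : Λ) = ⟨x.1, hx⟩ + ⟨y.1, hy⟩ := rfl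
    rw [this, map_add, hx', hy', Prod.snd_add, map_add]
  smul_mem' := by
    rintro c x ⟨hx, hx'⟩
    refine ⟨Λ.smul_mem c hx, ?_⟩
    have : (⟨(c • x).1, Λ.smul_mem c hx⟩ : Λ) = c • ⟨x.1, hx⟩ := rfl
    rw [this, map_smul, hx', Prod.smul_snd, map_smul]

theorem mem_gluedLattice {Λ : Submodule ℤ_[p] M} {I : Submodule ℤ_[p] ℤ_[p]}
    {h : Λ →ₗ[ℤ_[p]] (ℤ_[p] ⧸ I)} {x : M × ℤ_[p]} :
    x ∈ gluedLattice Λ I h ↔ ∃ hx : x.1 ∈ Λ, h ⟨x.1, hx⟩ = I.mkQ x.2 := Iff.rfl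

theorem map_fst_gluedLattice (Λ : Submodule ℤ_[p] M) (I : Submodule ℤ_[p] ℤ_[p])
    (h : Λ →ₗ[ℤ_[p]] (ℤ_[p] ⧸ I)) :
    (gluedLattice Λ I h).map (LinearMap.fst ℤ_[p] M ℤ_[p]) = Λ := by
  ext m
  constructor
  · rintro ⟨x, ⟨hx, -⟩, rfl⟩
    exact hx
  · intro hm
    obtain ⟨r, hr⟩ := I.mkQ_surjective (h ⟨m, hm⟩)
    exact ⟨(m, r), ⟨hm, hr.symm⟩, rfl⟩

theorem comap_inr_gluedLattice (Λ : Submodule ℤ_[p] M) (I : Submodule ℤ_[p] ℤ_[p])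
    (h : Λ →ₗ[ℤ_[p]] (ℤ_[p] ⧸ I)) :
    (gluedLattice Λ I h).comap (LinearMap.inr ℤ_[p] M ℤ_[p]) = I := by
  ext r
  rw [Submodule.mem_comap, mem_gluedLattice]
  have h0 : h ⟨(0 : M), Λ.zero_mem⟩ = 0 := map_zero h
  constructor
  · rintro ⟨hx, hr⟩
    have : I.mkQ r = 0 := hr.symm.trans h0
    exact (Submodule.Quotient.mk_eq_zero I).1 this
  · intro hr
    exact ⟨Λ.zero_mem, h0.trans ((Submodule.Quotient.mk_eq_zero I).2 hr).symm⟩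

theorem gluedLattice_injective (Λ : Submodule ℤ_[p] M) (I : Submodule ℤ_[p] ℤ_[p]) :
    Function.Injective (gluedLattice Λ I) := by
  intro h h' heq
  ext ⟨m, hm⟩
  obtain ⟨r, hr⟩ := I.mkQ_surjective (h ⟨m, hm⟩)
  have h1 : (m, r) ∈ gluedLattice Λ I h := ⟨hm, hr.symm⟩
  rw [heq] at h1
  obtain ⟨_, h2⟩ := h1
  exact hr.symm.trans h2.symm

/-- Because the projection of `Λ` is free, it lifts linearly back into `Λ`; the second coordinate of
the lift, taken modulo the fibre over `0`, is the glueing map. -/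
theorem exists_gluedLattice_eq (Λ : Submodule ℤ_[p] (M × ℤ_[p]))
    [Module.Free ℤ_[p] (Λ.map (LinearMap.fst ℤ_[p] M ℤ_[p]))] :
    ∃ h, gluedLattice (Λ.map (LinearMap.fst ℤ_[p] M ℤ_[p]))
      (Λ.comap (LinearMap.inr ℤ_[p] M ℤ_[p])) h = Λ := by
  set Λ' := Λ.map (LinearMap.fst ℤ_[p] M ℤ_[p]) with hΛ'
  set I := Λ.comap (LinearMap.inr ℤ_[p] M ℤ_[p]) with hI
  let b := Module.Free.chooseBasis ℤ_[p] Λ'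
  have hlift : ∀ i, ∃ r : ℤ_[p], ((b i : M), r) ∈ Λ := by
    intro i
    obtain ⟨⟨m, r⟩, hx, hm⟩ := (b i).2
    refine ⟨r, ?_⟩
    rw [← hm]
    exact hx
  choose r hr using hlift
  let g : Λ' →ₗ[ℤ_[p]] ℤ_[p] := b.constr ℤ_[p] r
  have hg : ∀ x : Λ', ((x : M), g x) ∈ Λ := by
    let ψ : Λ' →ₗ[ℤ_[p]] M × ℤ_[p] := Λ'.subtype.prod g
    have : LinearMap.range ψ ≤ Λ := by
      rw [LinearMap.range_eq_map, ← b.span_eq, Submodule.map_span, Submodule.span_le]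
      rintro _ ⟨_, ⟨i, rfl⟩, rfl⟩
      have : ψ (b i) = ((b i : M), r i) := by
        simp [ψ, g]
      rw [this]
      exact hr i
    intro x
    exact this ⟨x, rfl⟩
  refine ⟨I.mkQ ∘ₗ g, ?_⟩
  ext ⟨m, t⟩
  rw [mem_gluedLattice]
  have key : ∀ hm : m ∈ Λ', (I.mkQ (g ⟨m, hm⟩) = I.mkQ t ↔ (m, t) ∈ Λ) := by
    intro hm
    rw [← sub_eq_zero, ← map_sub, ← LinearMap.mem_ker, Submodule.ker_mkQ]
    change ((0 : M), g ⟨m, hm⟩ - t) ∈ Λ ↔ _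
    have h1 : ((0 : M), g ⟨m, hm⟩ - t) = (m, g ⟨m, hm⟩) - (m, t) := by simp
    rw [h1]
    exact Submodule.sub_mem_iff_right Λ (hg ⟨m, hm⟩)
  constructor
  · rintro ⟨hm, h⟩
    exact (key hm).1 h
  · intro h
    have hm : m ∈ Λ' := ⟨(m, t), h, rfl⟩
    exact ⟨hm, (key hm).2 h⟩

/-- The type of submodules of index `n`. -/
def LatticeOfIndex (p : ℕ) [Fact p.Prime] (M : Type*) [AddCommGroup M] [Module ℤ_[p] M]
    (n : ℕ) : Type _ := {Λ : Submodule ℤ_[p] M // latticeIndex Λ = n}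

/-- The number of sublattices of index `p ^ n` in `ℤ_p ^ d`, by recursion on `d`. -/
def latticeCount (p : ℕ) : ℕ → ℕ → ℕ
  | 0, n => if n = 0 then 1 else 0
  | d + 1, n => ∑ ij ∈ Finset.HasAntidiagonal.antidiagonal n, latticeCount p d ij.1 * (p ^ ij.2) ^ d

/-- Linear equivalences act on lattices of given index. -/
noncomputable def LatticeOfIndex.congr (e : M ≃ₗ[ℤ_[p]] N) (n : ℕ) :
    LatticeOfIndex p M n ≃ LatticeOfIndex p N n :=
  (Submodule.orderIsoMapComap e).toEquiv.subtypeEquiv fun Λ => by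
    rw [← latticeIndex_map_equiv e Λ]; rfl

theorem card_quotient_span_pow (k : ℕ) :
    Nat.card (ℤ_[p] ⧸ (Ideal.span {(p : ℤ_[p]) ^ k} : Submodule ℤ_[p] ℤ_[p])) = p ^ k :=
  latticeIndex_span_pow k

/-- All lattices in `M × ℤ_p` are obtained by glueing, in exactly one way. -/
theorem glueing_bijective [Module.Free ℤ_[p] M] [Module.Finite ℤ_[p] M] (n : ℕ) :
    ∃ F : (Σ ij : Finset.HasAntidiagonal.antidiagonal n, Σ Λ : LatticeOfIndex p M (p ^ ij.1.1),
        (Λ.1 →ₗ[ℤ_[p]] (ℤ_[p] ⧸ (Ideal.span {(p : ℤ_[p]) ^ ij.1.2} : Submodule ℤ_[p] ℤ_[p])))) →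
      LatticeOfIndex p (M × ℤ_[p]) (p ^ n), Function.Bijective F := by
  have hp : p.Prime := Fact.out
  refine ⟨fun x => ⟨gluedLattice x.2.1.1 _ x.2.2, ?_⟩, ?_, ?_⟩
  · rw [latticeIndex_prod, map_fst_gluedLattice, comap_inr_gluedLattice, x.2.1.2,
      latticeIndex_span_pow, ← pow_add, Finset.HasAntidiagonal.mem_antidiagonal.1 x.1.2]
  · rintro ⟨⟨⟨i, j⟩, hij⟩, ⟨Λ, hΛ⟩, h⟩ ⟨⟨⟨i', j'⟩, hij'⟩, ⟨Λ', hΛ'⟩, h'⟩ heq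
    have heq' : gluedLattice Λ _ h = gluedLattice Λ' _ h' := congrArg Subtype.val heq
    have h1 : Λ = Λ' := by
      have := congrArg (fun x => x.map (LinearMap.fst ℤ_[p] M ℤ_[p])) heq'
      simpa only [map_fst_gluedLattice] using this
    subst h1
    have h2 : i = i' := Nat.pow_right_injective hp.two_le (hΛ.symm.trans hΛ')
    subst h2
    have h3 : j = j' := by
      have := (Finset.HasAntidiagonal.mem_antidiagonal.1 hij).trans (Finset.HasAntidiagonal.mem_antidiagonal.1 hij').symm
      simpa using this
    subst h3
    have h4 := gluedLattice_injective _ _ heq'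
    subst h4
    rfl
  · rintro ⟨Λ, hΛ⟩
    have hfree : Module.Free ℤ_[p] (Λ.map (LinearMap.fst ℤ_[p] M ℤ_[p])) := inferInstance
    rw [latticeIndex_prod] at hΛ
    obtain ⟨i, -, hi⟩ := (Nat.dvd_prime_pow hp).1 (Dvd.intro _ hΛ)
    obtain ⟨j, -, hj⟩ := (Nat.dvd_prime_pow hp).1 (Dvd.intro_left _ hΛ)
    have hij : i + j = n := by
      rw [hi, hj, ← pow_add] at hΛ
      exact Nat.pow_right_injective hp.two_le hΛ
    obtain ⟨h, hh⟩ := exists_gluedLattice_eq Λ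
    have hI := eq_span_pow_of_latticeIndex hj
    revert h
    rw [hI]
    intro h hh
    exact ⟨⟨⟨(i, j), Finset.HasAntidiagonal.mem_antidiagonal.2 hij⟩, ⟨_, hi⟩, h⟩, Subtype.ext hh⟩

/-- The inductive step: a sublattice of finite index is free of the full rank, so it has
`(p^j)^rank` homomorphisms to `ℤ_p ⧸ p^j`, independently of the sublattice. -/
theorem finite_and_card_latticeOfIndex_prod [Module.Free ℤ_[p] M] [Module.Finite ℤ_[p] M]
    (h : ∀ n, Finite (LatticeOfIndex p M (p ^ n)) ∧
      Nat.card (LatticeOfIndex p M (p ^ n)) = latticeCount p (Module.finrank ℤ_[p] M) n) (n : ℕ) :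
    Finite (LatticeOfIndex p (M × ℤ_[p]) (p ^ n)) ∧
      Nat.card (LatticeOfIndex p (M × ℤ_[p]) (p ^ n)) =
        latticeCount p (Module.finrank ℤ_[p] M + 1) n := by
  have hp : p.Prime := Fact.out
  obtain ⟨F, hF⟩ := glueing_bijective (p := p) (M := M) n
  have hQ : ∀ k, Finite (ℤ_[p] ⧸ (Ideal.span {(p : ℤ_[p]) ^ k} : Submodule ℤ_[p] ℤ_[p])) :=
    fun k => Nat.finite_of_card_ne_zero (by
      rw [card_quotient_span_pow]; exact pow_ne_zero _ hp.ne_zero)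
  have hbasis : ∀ (i j : ℕ) (Λ : LatticeOfIndex p M (p ^ i)),
      Nonempty ((Fin (Module.finrank ℤ_[p] M) →
        (ℤ_[p] ⧸ (Ideal.span {(p : ℤ_[p]) ^ j} : Submodule ℤ_[p] ℤ_[p]))) ≃
        (Λ.1 →ₗ[ℤ_[p]] (ℤ_[p] ⧸ (Ideal.span {(p : ℤ_[p]) ^ j} : Submodule ℤ_[p] ℤ_[p])))) := by
    intro i j Λ
    have hr := finrank_eq_of_latticeIndex_ne_zero Λ.1
      (by rw [Λ.2]; exact pow_ne_zero _ hp.ne_zero)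
    exact ⟨((Module.finBasisOfFinrankEq ℤ_[p] Λ.1 hr).constr ℤ_[p]).toEquiv⟩
  have hHom : ∀ (i j : ℕ) (Λ : LatticeOfIndex p M (p ^ i)),
      Finite (Λ.1 →ₗ[ℤ_[p]]
        (ℤ_[p] ⧸ (Ideal.span {(p : ℤ_[p]) ^ j} : Submodule ℤ_[p] ℤ_[p]))) ∧
      Nat.card (Λ.1 →ₗ[ℤ_[p]]
        (ℤ_[p] ⧸ (Ideal.span {(p : ℤ_[p]) ^ j} : Submodule ℤ_[p] ℤ_[p]))) =
        (p ^ j) ^ Module.finrank ℤ_[p] M := by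
    intro i j Λ
    obtain ⟨e⟩ := hbasis i j Λ
    have := hQ j
    refine ⟨Finite.of_equiv _ e, ?_⟩
    rw [← Nat.card_congr e, Nat.card_fun, card_quotient_span_pow, Nat.card_fin]
  have hfin1 : ∀ ij : Finset.HasAntidiagonal.antidiagonal n, Finite (Σ Λ : LatticeOfIndex p M (p ^ ij.1.1),
        (Λ.1 →ₗ[ℤ_[p]]
          (ℤ_[p] ⧸ (Ideal.span {(p : ℤ_[p]) ^ ij.1.2} : Submodule ℤ_[p] ℤ_[p])))) := by
    intro ij
    have := (h ij.1.1).1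
    have := fun Λ => (hHom ij.1.1 ij.1.2 Λ).1
    infer_instance
  refine ⟨Finite.of_surjective F hF.2, ?_⟩
  rw [← Nat.card_congr (Equiv.ofBijective F hF), Nat.card_sigma, latticeCount,
    ← Finset.sum_coe_sort (Finset.HasAntidiagonal.antidiagonal n)]
  refine Finset.sum_congr rfl fun ij _ => ?_
  have := (h ij.1.1).1
  have := Fintype.ofFinite (LatticeOfIndex p M (p ^ ij.1.1))
  have := fun Λ => (hHom ij.1.1 ij.1.2 Λ).1
  rw [Nat.card_sigma]
  refine (Finset.sum_congr rfl fun Λ _ => (hHom ij.1.1 ij.1.2 Λ).2).trans ?_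
  rw [Finset.sum_const, Finset.card_univ, ← Nat.card_eq_fintype_card, (h ij.1.1).2, smul_eq_mul]

theorem finite_and_card_latticeOfIndex_punit (n : ℕ) :
    Finite (LatticeOfIndex p PUnit.{1} (p ^ n)) ∧
      Nat.card (LatticeOfIndex p PUnit.{1} (p ^ n)) = latticeCount p 0 n := by
  have hp : p.Prime := Fact.out
  have h1 : ∀ Λ : Submodule ℤ_[p] PUnit, latticeIndex Λ = 1 := by
    intro Λ
    rw [Subsingleton.elim Λ ⊤]
    exact AddSubgroup.index_top
  have hs : Subsingleton (LatticeOfIndex p PUnit.{1} (p ^ n)) := by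
    unfold LatticeOfIndex; infer_instance
  refine ⟨inferInstance, ?_⟩
  rw [latticeCount]
  split_ifs with h
  · have : Nonempty (LatticeOfIndex p PUnit.{1} (p ^ n)) := ⟨⟨⊤, by rw [h1, h, pow_zero]⟩⟩
    exact Nat.card_unique
  · have : IsEmpty (LatticeOfIndex p PUnit.{1} (p ^ n)) :=
      ⟨fun Λ => h ((Nat.pow_right_injective hp.two_le) ((Λ.2.symm.trans (h1 _)).trans (pow_zero p).symm))⟩
    exact Nat.card_of_isEmpty

theorem finite_and_card_latticeOfIndex_fin (d n : ℕ) :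
    Finite (LatticeOfIndex p (Fin d → ℤ_[p]) (p ^ n)) ∧
      Nat.card (LatticeOfIndex p (Fin d → ℤ_[p]) (p ^ n)) = latticeCount p d n := by
  induction d generalizing n with
  | zero =>
    have e : PUnit.{1} ≃ₗ[ℤ_[p]] (Fin 0 → ℤ_[p]) :=
      LinearEquiv.ofFinrankEq _ _ (by
        rw [Module.finrank_zero_of_subsingleton, Module.finrank_zero_of_subsingleton])
    have e' := LatticeOfIndex.congr e (p ^ n)
    have := (finite_and_card_latticeOfIndex_punit (p := p) n).1
    exact ⟨Finite.of_equiv _ e', (Nat.card_congr e').symm.trans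
      (finite_and_card_latticeOfIndex_punit (p := p) n).2⟩
  | succ d ih =>
    have e : ((Fin d → ℤ_[p]) × ℤ_[p]) ≃ₗ[ℤ_[p]] (Fin (d + 1) → ℤ_[p]) :=
      LinearEquiv.ofFinrankEq _ _ (by simp)
    have e' := LatticeOfIndex.congr e (p ^ n)
    have h := finite_and_card_latticeOfIndex_prod (p := p) (M := Fin d → ℤ_[p])
      (by simpa using ih) n
    have := h.1
    exact ⟨Finite.of_equiv _ e', (Nat.card_congr e').symm.trans (by simpa using h.2)⟩

variable [Module.Free ℤ_[p] M] [Module.Finite ℤ_[p] M]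

instance finite_latticeOfIndex (n : ℕ) : Finite (LatticeOfIndex p M (p ^ n)) := by
  have := (finite_and_card_latticeOfIndex_fin (p := p) (Module.finrank ℤ_[p] M) n).1
  exact Finite.of_equiv _ (LatticeOfIndex.congr (Module.finBasis ℤ_[p] M).equivFun.symm (p ^ n))

theorem card_latticeOfIndex (n : ℕ) :
    Nat.card (LatticeOfIndex p M (p ^ n)) = latticeCount p (Module.finrank ℤ_[p] M) n :=
  (Nat.card_congr (LatticeOfIndex.congr (Module.finBasis ℤ_[p] M).equivFun (p ^ n))).trans
    (finite_and_card_latticeOfIndex_fin _ n).2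

end LatticeCount

/-! ### Sublattices of a lattice, and Dirichlet series as power series. -/

section GeneratingFunctions

variable {p : ℕ} [Fact p.Prime]
variable {M : Type*} [AddCommGroup M] [Module ℤ_[p] M]

theorem latticeIndex_map_subtype (K : Submodule ℤ_[p] M) (Λ : Submodule ℤ_[p] K) :
    latticeIndex (Λ.map K.subtype) = latticeIndex Λ * latticeIndex K := by
  have hle : (Λ.map K.subtype).toAddSubgroup ≤ K.toAddSubgroup := Submodule.map_subtype_le K Λ
  have h := AddSubgroup.relIndex_mul_index hle
  unfold latticeIndex
  rw [← h]
  congr 1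
  rw [AddSubgroup.relIndex]
  congr 1
  ext x
  rw [AddSubgroup.mem_addSubgroupOf]
  exact ⟨fun ⟨y, hy, hxy⟩ => by rwa [← Subtype.ext hxy], fun hx => ⟨x, hx, rfl⟩⟩

/-- By multiplicativity of the index these are the sublattices of index `p^c` in `K`, which is free
of the same rank as `M`. This makes the number of lattices seen by a functional depend only on its
content. -/
theorem card_latticeOfIndex_le [Module.Free ℤ_[p] M] [Module.Finite ℤ_[p] M]
    {K : Submodule ℤ_[p] M} {c d : ℕ} (hcd : c ≤ d) (hK : latticeIndex K = p ^ (d - c)) :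
    Nat.card {Λ : LatticeOfIndex p M (p ^ d) // Λ.1 ≤ K} =
      latticeCount p (Module.finrank ℤ_[p] M) c := by
  have hp : p.Prime := Fact.out
  have hr := finrank_eq_of_latticeIndex_ne_zero K (by rw [hK]; exact pow_ne_zero _ hp.ne_zero)
  rw [← hr, ← card_latticeOfIndex (p := p) (M := K) c]
  refine (Nat.card_congr ?_).symm
  have key : ∀ Λ : Submodule ℤ_[p] K,
      latticeIndex Λ = p ^ c ↔ latticeIndex (Λ.map K.subtype) = p ^ d := by
    intro Λ
    rw [latticeIndex_map_subtype, hK, ← Nat.add_sub_of_le hcd, pow_add, Nat.add_sub_cancel_left]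
    exact ⟨fun h => by rw [h], fun h => Nat.eq_of_mul_eq_mul_right (pow_pos hp.pos _) h⟩
  refine Equiv.ofBijective
    (fun Λ => ⟨⟨Λ.1.map K.subtype, (key Λ.1).1 Λ.2⟩, Submodule.map_subtype_le K Λ.1⟩) ⟨?_, ?_⟩
  · intro Λ Λ' h
    have h' : Λ.1.map K.subtype = Λ'.1.map K.subtype := congrArg (fun x => x.1.1) h
    exact Subtype.ext (Submodule.map_injective_of_injective K.injective_subtype h')
  · rintro ⟨⟨Λ, hΛ⟩, hle⟩
    have hmap : (Λ.comap K.subtype).map K.subtype = Λ := by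
      rw [Submodule.map_comap_subtype, inf_eq_right.2 hle]
    exact ⟨⟨Λ.comap K.subtype, (key _).2 (by rw [hmap]; exact hΛ)⟩,
      Subtype.ext (Subtype.ext hmap)⟩

omit [Fact p.Prime] in
/-- The generating function of `latticeCount`. -/
theorem summable_latticeCount (d : ℕ) (X : ℂ) (hX : ∀ i < d, ‖(p : ℂ) ^ i * X‖ < 1) :
    Summable (fun n => ‖(latticeCount p d n : ℂ) * X ^ n‖) ∧
      ∑' n, (latticeCount p d n : ℂ) * X ^ n =
        ∏ i ∈ Finset.range d, (1 - (p : ℂ) ^ i * X)⁻¹ := by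
  induction d with
  | zero =>
    have h0 : ∀ n, n ≠ 0 → (latticeCount p 0 n : ℂ) * X ^ n = 0 := by
      intro n hn
      simp [latticeCount, hn]
    refine ⟨summable_of_ne_finset_zero (s := {0}) fun n hn => ?_, ?_⟩
    · rw [h0 n (by simpa using hn), norm_zero]
    · rw [tsum_eq_single 0 h0]
      simp [latticeCount]
  | succ d ih =>
    obtain ⟨hs, ht⟩ := ih fun i hi => hX i (by omega)
    have hd := hX d (by omega)
    have hg : Summable (fun n => ‖((p : ℂ) ^ d * X) ^ n‖) := by
      simpa only [norm_pow] using summable_geometric_of_lt_one (norm_nonneg _) hd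
    have hterm : ∀ n, (latticeCount p (d + 1) n : ℂ) * X ^ n =
        ∑ kl ∈ Finset.HasAntidiagonal.antidiagonal n,
          ((latticeCount p d kl.1 : ℂ) * X ^ kl.1) * ((p : ℂ) ^ d * X) ^ kl.2 := by
      intro n
      rw [latticeCount, Nat.cast_sum, Finset.sum_mul]
      refine Finset.sum_congr rfl fun kl hkl => ?_
      rw [← Finset.HasAntidiagonal.mem_antidiagonal.1 hkl]
      push_cast
      rw [← pow_mul, mul_comm kl.2 d, pow_mul, pow_add, mul_pow]
      ring
    have h1 := summable_norm_sum_mul_antidiagonal_of_summable_norm hs hg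
    have h2 := tsum_mul_tsum_eq_tsum_sum_antidiagonal_of_summable_norm hs hg
    refine ⟨h1.congr fun n => by rw [hterm], ?_⟩
    rw [tsum_congr hterm, ← h2, ht, tsum_geometric_of_norm_lt_one hd, Finset.prod_range_succ]

theorem summable_pow_of_finite_fibers {T : Type*} (deg : T → ℕ) (c : ℕ → ℕ) (X : ℂ)
    (hfin : ∀ n, Finite {x // deg x = n}) (hc : ∀ n, Nat.card {x // deg x = n} = c n)
    (hs : Summable (fun n => ‖(c n : ℂ) * X ^ n‖)) :
    Summable (fun x => X ^ deg x) ∧ ∑' x, X ^ deg x = ∑' n, (c n : ℂ) * X ^ n := by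
  have hval : ∀ (n : ℕ) (y : {x // deg x = n}),
      X ^ deg (Equiv.sigmaFiberEquiv deg ⟨n, y⟩) = X ^ n := fun n y => by
    rw [show deg (Equiv.sigmaFiberEquiv deg ⟨n, y⟩) = n from y.2]
  have hfib : ∀ (n : ℕ) (a : ℂ), ∑' _ : {x // deg x = n}, a = (c n : ℂ) * a := by
    intro n a
    rw [tsum_const, hc, nsmul_eq_mul]
  have hfib' : ∀ (n : ℕ) (a : ℝ), ∑' _ : {x // deg x = n}, a = (c n : ℝ) * a := by
    intro n a
    rw [tsum_const, hc, nsmul_eq_mul]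
  have hsig : Summable (fun z => X ^ deg (Equiv.sigmaFiberEquiv deg z)) := by
    refine Summable.of_norm ?_
    rw [summable_sigma_of_nonneg fun _ => norm_nonneg _]
    refine ⟨fun n => ?_, ?_⟩
    · have := hfin n
      exact Summable.of_finite
    · refine hs.congr fun n => ?_
      simp only [hval]
      rw [hfib']
      simp
  refine ⟨(Equiv.sigmaFiberEquiv deg).summable_iff.1 hsig, ?_⟩
  rw [← (Equiv.sigmaFiberEquiv deg).tsum_eq, hsig.tsum_sigma]
  refine tsum_congr fun n => ?_
  simp only [hval]
  exact hfib n _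

end GeneratingFunctions

/-! ### Haar volumes in `ℤ_p^d`. -/

section HaarVolume

variable {p : ℕ} [Fact p.Prime]

instance isProbabilityMeasure_padicInt : IsProbabilityMeasure (volume : Measure ℤ_[p]) := by
  constructor
  change Measure.addHaarMeasure _ _ = _
  simpa using Measure.addHaarMeasure_self (K₀ := (⊤ : TopologicalSpace.PositiveCompacts ℤ_[p]))

instance isAddHaarMeasure_padicInt : Measure.IsAddHaarMeasure (volume : Measure ℤ_[p]) := by
  change Measure.IsAddHaarMeasure (Measure.addHaarMeasure _)
  infer_instance

theorem measurableSet_setOf_dvd {α : Type*} [TopologicalSpace α] [MeasurableSpace α]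
    [OpensMeasurableSpace α] {g : α → ℤ_[p]} (hg : Continuous g) (k : ℕ) :
    MeasurableSet {x | (p : ℤ_[p]) ^ k ∣ g x} := by
  have : {x | (p : ℤ_[p]) ^ k ∣ g x} = {x | ‖g x‖ ≤ (p : ℝ) ^ (-(k : ℤ))} := by
    ext x
    simp only [Set.mem_ofPred_eq]
    rw [PadicInt.norm_le_pow_iff_mem_span_pow, Ideal.mem_span_singleton]
  rw [this]
  exact (isClosed_le hg.norm continuous_const).measurableSet

/-- The `p^k` residue classes are translates of this set and partition a space of mass `1`. -/
theorem volume_dvd (k : ℕ) :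
    (volume : Measure ℤ_[p]).real {x | (p : ℤ_[p]) ^ k ∣ x} = ((p : ℝ) ^ k)⁻¹ := by
  have hp : p.Prime := Fact.out
  have : NeZero (p ^ k) := ⟨pow_ne_zero _ hp.ne_zero⟩
  set A : Set ℤ_[p] := {x | (p : ℤ_[p]) ^ k ∣ x} with hA
  have hAm : MeasurableSet A := measurableSet_setOf_dvd continuous_id k
  have hker : ∀ x, x ∈ A ↔ PadicInt.toZModPow (p := p) k x = 0 := by
    intro x
    rw [← RingHom.mem_ker, PadicInt.ker_toZModPow, Ideal.mem_span_singleton]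
    rfl
  obtain ⟨g, hg⟩ := (ZMod.ringHom_surjective (PadicInt.toZModPow (p := p) k)).hasRightInverse
  have hcos : ∀ z : ZMod (p ^ k), PadicInt.toZModPow (p := p) k ⁻¹' {z} =
      (fun x => -g z + x) ⁻¹' A := by
    intro z
    ext x
    rw [Set.mem_preimage, Set.mem_preimage, hker, map_add, map_neg, hg z, neg_add_eq_zero,
      Set.mem_singleton_iff, eq_comm]
  have hvol : ∀ z : ZMod (p ^ k), (volume : Measure ℤ_[p]).real
      (PadicInt.toZModPow (p := p) k ⁻¹' {z}) = (volume : Measure ℤ_[p]).real A := by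
    intro z
    rw [hcos, measureReal_def, measure_preimage_add, measureReal_def]
  have hsum := measureReal_biUnion_finset (μ := (volume : Measure ℤ_[p]))
    (s := (Finset.univ : Finset (ZMod (p ^ k))))
    (f := fun z => PadicInt.toZModPow (p := p) k ⁻¹' {z})
    (fun a _ b _ hab => Disjoint.preimage _ (by simpa using hab))
    (fun z _ => by rw [hcos]; exact measurable_const_add _ hAm)
  have huniv : (⋃ z ∈ (Finset.univ : Finset (ZMod (p ^ k))),
      PadicInt.toZModPow (p := p) k ⁻¹' {z}) = Set.univ := by
    ext x; simp
  rw [huniv, Finset.sum_congr rfl fun z _ => hvol z, Finset.sum_const, Finset.card_univ,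
    ZMod.card] at hsum
  simp only [probReal_univ, nsmul_eq_mul, Nat.cast_pow] at hsum
  exact eq_inv_of_mul_eq_one_right hsum.symm

/-- Boxes `p^{k_0} ℤ_p × p^{k_1} ℤ_p × p^{k_2} ℤ_p` have the expected volume. -/
theorem volume_box {d : ℕ} (k : Fin d → ℕ) :
    (volume : Measure (Fin d → ℤ_[p])).real {x | ∀ i, (p : ℤ_[p]) ^ k i ∣ x i} =
      ((p : ℝ) ^ ∑ i, k i)⁻¹ := by
  have : {x : Fin d → ℤ_[p] | ∀ i, (p : ℤ_[p]) ^ k i ∣ x i} =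
      Set.univ.pi fun i => {x | (p : ℤ_[p]) ^ k i ∣ x} := by
    ext x; simp
  rw [this, measureReal_def, volume_pi_pi, ENNReal.toReal_prod]
  simp only [← measureReal_def, volume_dvd]
  rw [Finset.prod_inv_distrib, Finset.prod_pow_eq_pow_sum]

/-- The image measure is again a Haar probability measure, and there is only one. -/
theorem measurePreserving_linearEquiv {d : ℕ} (e : (Fin d → ℤ_[p]) ≃ₗ[ℤ_[p]] (Fin d → ℤ_[p])) :
    MeasurePreserving e := by
  have hc : ∀ g : (Fin d → ℤ_[p]) →ₗ[ℤ_[p]] (Fin d → ℤ_[p]), Continuous g := fun g =>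
    LinearMap.continuous_on_pi g
  let e' : (Fin d → ℤ_[p]) ≃ₜ+ (Fin d → ℤ_[p]) :=
    { e.toAddEquiv with
      continuous_toFun := hc e
      continuous_invFun := hc e.symm }
  have hm : Measurable e := (hc e).measurable
  refine ⟨hm, ?_⟩
  have h1 : Measure.IsAddHaarMeasure (Measure.map e (volume : Measure (Fin d → ℤ_[p]))) :=
    ContinuousAddEquiv.isAddHaarMeasure_map volume e'
  have h2 : IsProbabilityMeasure (Measure.map e (volume : Measure (Fin d → ℤ_[p]))) :=
    Measure.isProbabilityMeasure_map hm.aemeasurable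
  exact Measure.isAddHaarMeasure_eq_of_isProbabilityMeasure _ _

/-- Multiplication by `p^c` scales volumes in `ℤ_p^d` by `p^{-cd}`. -/
theorem volume_smul_image {d : ℕ} (c : ℕ) (A : Set (Fin d → ℤ_[p])) :
    (volume : Measure (Fin d → ℤ_[p])).real ((fun x => (p : ℤ_[p]) ^ c • x) '' A) =
      ((p : ℝ) ^ (d * c))⁻¹ * (volume : Measure (Fin d → ℤ_[p])).real A := by
  have hp : p.Prime := Fact.out
  set φ : (Fin d → ℤ_[p]) → (Fin d → ℤ_[p]) := fun x => (p : ℤ_[p]) ^ c • x with hφ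
  have hφc : Continuous φ := continuous_const_smul _
  have hp0 : (p : ℤ_[p]) ^ c ≠ 0 := pow_ne_zero _ (by exact_mod_cast hp.ne_zero)
  have hφi : Function.Injective φ := fun x y h => smul_right_injective _ hp0 h
  have hemb : MeasurableEmbedding φ := (hφc.isClosedEmbedding hφi).measurableEmbedding
  set μ : Measure (Fin d → ℤ_[p]) := Measure.comap φ volume with hμ
  have hμA : ∀ B, μ B = volume (φ '' B) := fun B => hemb.comap_apply _ _
  have hinv : μ.IsAddLeftInvariant := by
    refine ⟨fun g => ?_⟩
    ext B hB
    rw [Measure.map_apply (measurable_const_add g) hB, hμA, hμA]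
    have : φ '' ((fun x => g + x) ⁻¹' B) = (fun x => φ g + x) ⁻¹' (φ '' B) := by
      ext y
      constructor
      · rintro ⟨x, hx, rfl⟩
        exact ⟨g + x, hx, by simp [hφ, smul_add]⟩
      · rintro ⟨x, hx, hxy⟩
        refine ⟨-g + x, by simpa using hx, ?_⟩
        have : φ x = φ g + y := hxy
        simp only [hφ] at this ⊢
        rw [smul_add, this, smul_neg]
        simp
    rw [this, measure_preimage_add]
  have hfin : IsFiniteMeasure μ := ⟨by rw [hμA]; exact measure_lt_top _ _⟩
  have huniq := Measure.isAddLeftInvariant_eq_smul μ (volume : Measure (Fin d → ℤ_[p]))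
  set k := μ.addHaarScalarFactor (volume : Measure (Fin d → ℤ_[p])) with hk
  have hreal : ∀ B, (volume : Measure (Fin d → ℤ_[p])).real (φ '' B) =
      (k : ℝ) * (volume : Measure (Fin d → ℤ_[p])).real B := by
    intro B
    rw [measureReal_def, ← hμA, huniq]
    simp [measureReal_def]
  have himg : φ '' Set.univ = {x | ∀ _ : Fin d, (p : ℤ_[p]) ^ c ∣ x ‹_›} := by
    ext y
    constructor
    · rintro ⟨x, -, rfl⟩ i
      exact ⟨x i, rfl⟩
    · intro h
      choose x hx using h
      exact ⟨x, trivial, funext fun i => (hx i).symm⟩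
  -- The scaling factor supplied by uniqueness of Haar measure is read off from the whole space,
  -- whose image is a box.
  have h1 := hreal Set.univ
  rw [himg, volume_box (fun _ => c), probReal_univ, mul_one] at h1
  rw [hreal, ← h1]
  simp
end HaarVolume

/-! ### The structure form as an alternating expression, and Smith bases. -/

section SmithForm

variable {p : ℕ} [Fact p.Prime]
variable {L : Type*} [AddCommGroup L] [Module ℤ_[p] L]

/-- The alternating trilinear expression whose value on a basis is the structure form. -/
noncomputable def formValue (β : L →ₗ[ℤ_[p]] L →ₗ[ℤ_[p]] L) (v : Fin 3 → L) (φ : L →ₗ[ℤ_[p]] ℤ_[p]) : ℤ_[p] :=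
  φ (β (v 1) (v 2)) * φ (v 0) - φ (β (v 0) (v 2)) * φ (v 1) + φ (β (v 0) (v 1)) * φ (v 2)

theorem eval_structureForm (β : L →ₗ[ℤ_[p]] L →ₗ[ℤ_[p]] L) (e : Module.Basis (Fin 3) ℤ_[p] L)
    (x : Fin 3 → ℤ_[p]) :
    MvPolynomial.eval x (structureForm β e) = formValue β e (e.constr ℤ_[p] x) := by
  have h : ∀ i j, MvPolynomial.eval x (structureLinearForm β e i j) =
      e.constr ℤ_[p] x (β (e i) (e j)) := by
    intro i j
    rw [Module.Basis.constr_apply_fintype, structureLinearForm, map_sum]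
    simp [structureConstant]
  simp [structureForm, formValue, h]

/-- Antisymmetry gives `2 β(x,x) = 0`; torsion-freeness then suffices, also for `p = 2`. -/
theorem bracket_self {β : L →ₗ[ℤ_[p]] L →ₗ[ℤ_[p]] L} [Module.IsTorsionFree ℤ_[p] L]
    (hβ : ∀ x y : L, β x y = -β y x) (x : L) : β x x = 0 := by
  have h : (2 : ℤ_[p]) • β x x = 0 := by
    rw [two_smul]
    nth_rewrite 1 [hβ x x]
    simp
  exact (smul_eq_zero.1 h).resolve_left two_ne_zero

/-- For fixed `φ` the expression is trilinear and alternating in three vectors, hence scales by the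
determinant. -/
theorem formValue_change {β : L →ₗ[ℤ_[p]] L →ₗ[ℤ_[p]] L} [Module.IsTorsionFree ℤ_[p] L]
    (hβ : ∀ x y : L, β x y = -β y x) (v w : Fin 3 → L) (P : Matrix (Fin 3) (Fin 3) ℤ_[p])
    (hw : ∀ i, w i = ∑ j, P i j • v j) (φ : L →ₗ[ℤ_[p]] ℤ_[p]) :
    formValue β w φ = P.det * formValue β v φ := by
  have h10 := hβ (v 1) (v 0)
  have h20 := hβ (v 2) (v 0)
  have h21 := hβ (v 2) (v 1)
  simp only [formValue, hw, Fin.sum_univ_three, map_add, map_smul, LinearMap.add_apply,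
    LinearMap.smul_apply, smul_eq_mul, bracket_self hβ, h10, h20, h21, map_neg, map_zero,
    Matrix.det_fin_three]
  ring

theorem exists_eq_pow_mul_unit {x : ℤ_[p]} (hx : x ≠ 0) :
    ∃ (n : ℕ) (u : ℤ_[p]ˣ), x = (p : ℤ_[p]) ^ n * u :=
  ⟨x.valuation, PadicInt.unitCoeff hx, by rw [mul_comm]; exact PadicInt.unitCoeff_spec hx⟩

/-- If membership in `Λ` is given by divisibility conditions on coordinates, its index is known. -/
theorem latticeIndex_of_diagonal (e : Module.Basis (Fin 3) ℤ_[p] L) (n : Fin 3 → ℕ)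
    (Λ : Submodule ℤ_[p] L) (h : ∀ x, x ∈ Λ ↔ ∀ i, (p : ℤ_[p]) ^ n i ∣ e.repr x i) :
    latticeIndex Λ = p ^ ∑ i, n i := by
  let g : L →+ (∀ i, ZMod (p ^ n i)) := AddMonoidHom.pi fun i =>
    (PadicInt.toZModPow (p := p) (n i)).toAddMonoidHom.comp
      ((Pi.evalAddMonoidHom (fun _ : Fin 3 => ℤ_[p]) i).comp e.equivFun.toAddEquiv.toAddMonoidHom)
  have hg : ∀ x i, g x i = PadicInt.toZModPow (p := p) (n i) (e.repr x i) := fun x i => rfl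
  have hker : Λ.toAddSubgroup = g.ker := by
    ext x
    rw [Submodule.mem_toAddSubgroup, h, AddMonoidHom.mem_ker, funext_iff]
    refine forall_congr' fun i => ?_
    rw [hg, Pi.zero_apply, ← RingHom.mem_ker, PadicInt.ker_toZModPow, Ideal.mem_span_singleton]
  have hsurj : g.range = ⊤ := by
    rw [AddMonoidHom.range_eq_top]
    intro z
    choose y hy using fun i => ZMod.ringHom_surjective (PadicInt.toZModPow (p := p) (n i)) (z i)
    refine ⟨e.equivFun.symm y, funext fun i => ?_⟩
    rw [hg, ← hy i]
    congr 1
    exact congrFun (e.equivFun.apply_symm_apply y) i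
  rw [latticeIndex, hker, AddSubgroup.index_ker, hsurj,
    Nat.card_congr AddSubgroup.topEquiv.toEquiv, Nat.card_pi]
  simp only [Nat.card_zmod]
  exact Finset.prod_pow_eq_pow_sum _ _ _

/-- Smith normal form: the elementary divisors are powers of `p` up to units, and the basis is
reindexed to sort the exponents. -/
theorem exists_diagonal_basis (e : Module.Basis (Fin 3) ℤ_[p] L) (Λ : Submodule ℤ_[p] L)
    (hΛ : latticeIndex Λ ≠ 0) :
    ∃ (b : Module.Basis (Fin 3) ℤ_[p] L) (n : Fin 3 → ℕ), Monotone n ∧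
      ∀ x, x ∈ Λ ↔ ∀ i, (p : ℤ_[p]) ^ n i ∣ b.repr x i := by
  have : Module.Free ℤ_[p] L := Module.Free.of_basis e
  have : Module.Finite ℤ_[p] L := Module.Finite.of_basis e
  obtain ⟨b, a, ab, hab⟩ := Submodule.exists_smith_normal_form_of_rank_eq e
    (finrank_eq_of_latticeIndex_ne_zero Λ hΛ)
  have ha : ∀ i, a i ≠ 0 := by
    intro i hi
    apply ab.ne_zero i
    apply Subtype.ext
    rw [hab, hi, zero_smul]
    rfl
  choose n u hu using fun i => exists_eq_pow_mul_unit (ha i)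
  have hmem : ∀ x, x ∈ Λ ↔ ∀ i, (p : ℤ_[p]) ^ n i ∣ b.repr x i := by
    intro x
    constructor
    · intro hx i
      have h1 : x = ∑ j, (ab.repr ⟨x, hx⟩ j * a j) • b j := by
        have h2 := congrArg Subtype.val (ab.sum_repr ⟨x, hx⟩)
        simp only [AddSubmonoidClass.coe_finsetSum, SetLike.val_smul, hab, smul_smul] at h2
        exact h2.symm
      have h3 : b.repr x i = ab.repr ⟨x, hx⟩ i * a i := by
        conv_lhs => rw [h1]
        exact congrFun (b.repr_sum_self _) i
      rw [h3, hu i]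
      exact Dvd.intro_left (ab.repr ⟨x, hx⟩ i * u i) (by ring)
    · intro h
      rw [← b.sum_repr x]
      refine Submodule.sum_mem _ fun i _ => ?_
      obtain ⟨c, hc⟩ := h i
      have : b.repr x i • b i = (c * ((u i)⁻¹ : ℤ_[p]ˣ)) • (ab i : L) := by
        rw [hab, smul_smul, hc, hu i]
        congr 1
        rw [mul_assoc, mul_comm _ (u i : ℤ_[p]), ← mul_assoc _ (u i : ℤ_[p]), Units.inv_mul,
          one_mul, mul_comm]
      rw [this]
      exact Λ.smul_mem _ (ab i).2
  refine ⟨b.reindex (Tuple.sort n).symm, n ∘ Tuple.sort n, Tuple.monotone_sort n, fun x => ?_⟩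
  rw [hmem]
  simp only [Module.Basis.repr_reindex_apply, Equiv.symm_symm, Function.comp_apply]
  exact (Equiv.forall_congr_right (Tuple.sort n)
    (q := fun i => (p : ℤ_[p]) ^ n i ∣ b.repr x i)).symm

end SmithForm

/-! ### Closure and the structure form in a Smith basis. -/

section DiagonalLattice

variable {p : ℕ} [Fact p.Prime]
variable {L : Type*} [AddCommGroup L] [Module ℤ_[p] L]
variable {b : Module.Basis (Fin 3) ℤ_[p] L} {n : Fin 3 → ℕ} {Λ : Submodule ℤ_[p] L}
variable {β : L →ₗ[ℤ_[p]] L →ₗ[ℤ_[p]] L}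

theorem smul_basis_mem_of_diagonal (h : ∀ x, x ∈ Λ ↔ ∀ i, (p : ℤ_[p]) ^ n i ∣ b.repr x i)
    (i : Fin 3) : (p : ℤ_[p]) ^ n i • b i ∈ Λ := by
  rw [h]
  intro j
  by_cases hij : i = j
  · subst hij; simp
  · simp [hij]

/-- A diagonal lattice is a subalgebra if and only if one divisibility condition holds. -/
theorem closed_iff_of_diagonal (hβ : ∀ x y : L, β x y = -β y x) (hn : Monotone n)
    (h : ∀ x, x ∈ Λ ↔ ∀ i, (p : ℤ_[p]) ^ n i ∣ b.repr x i) :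
    (∀ x ∈ Λ, ∀ y ∈ Λ, β x y ∈ Λ) ↔
      (p : ℤ_[p]) ^ n 2 ∣ (p : ℤ_[p]) ^ (n 0 + n 1) * b.repr (β (b 0) (b 1)) 2 := by
  have : Module.Free ℤ_[p] L := Module.Free.of_basis b
  constructor
  · intro hcl
    have h1 := hcl _ (smul_basis_mem_of_diagonal h 0) _ (smul_basis_mem_of_diagonal h 1)
    have h2 := (h _).1 h1 2
    simpa [pow_add, mul_assoc, mul_left_comm] using h2
  · intro hdvd
    have hle : ∀ i, n i ≤ n 2 := fun i => hn (by omega)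
    have h01 : n 0 ≤ n 1 := hn (by decide)
    -- Products involving `b 2` lie in `p^(n 2) L ⊆ Λ` automatically, so only the `b 2`-coordinate
    -- of `β (b 0) (b 1)` can obstruct closure.
    have hbig : ∀ i j, n 2 ≤ n i + n j → (p : ℤ_[p]) ^ (n i + n j) • β (b i) (b j) ∈ Λ := by
      intro i j hij
      rw [h]
      intro k
      rw [map_smul, Finsupp.smul_apply, smul_eq_mul]
      exact Dvd.dvd.mul_right (pow_dvd_pow _ ((hle k).trans hij)) _
    have hsmall : (p : ℤ_[p]) ^ (n 0 + n 1) • β (b 0) (b 1) ∈ Λ := by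
      rw [h]
      intro k
      rw [map_smul, Finsupp.smul_apply, smul_eq_mul]
      by_cases hk : k = 2
      · subst hk; exact hdvd
      · refine Dvd.dvd.mul_right (pow_dvd_pow _ ?_) _
        have : n k ≤ n 1 := hn (by omega)
        omega
    have hall : ∀ i j, (p : ℤ_[p]) ^ (n i + n j) • β (b i) (b j) ∈ Λ := by
      intro i j
      by_cases hij : i = j
      · subst hij
        rw [bracket_self hβ, smul_zero]
        exact Λ.zero_mem
      by_cases hi : i = 2
      · subst hi; exact hbig _ _ (by omega)
      by_cases hj : j = 2
      · subst hj; exact hbig _ _ (by omega)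
      by_cases hi0 : i = 0
      · have hj1 : j = 1 := by omega
        subst hi0; subst hj1; exact hsmall
      · have hi1 : i = 1 := by omega
        have hj0 : j = 0 := by omega
        subst hi1; subst hj0
        rw [hβ, smul_neg, add_comm]
        exact Λ.neg_mem hsmall
    intro x hx y hy
    choose c hc using (h x).1 hx
    choose c' hc' using (h y).1 hy
    have hexp : β x y = ∑ i, ∑ j, (c i * c' j) • ((p : ℤ_[p]) ^ (n i + n j) • β (b i) (b j)) := by
      conv_lhs => rw [← b.sum_repr x, ← b.sum_repr y]
      rw [LinearMap.map_sum₂]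
      refine Finset.sum_congr rfl fun i _ => ?_
      rw [map_sum]
      refine Finset.sum_congr rfl fun j _ => ?_
      rw [LinearMap.map_smul₂, map_smul, hc, hc', smul_smul, smul_smul, pow_add]
      congr 1
      ring
    rw [hexp]
    exact Submodule.sum_mem _ fun i _ => Submodule.sum_mem _ fun j _ => Λ.smul_mem _ (hall i j)

/-- Modulo `p^d` the structure form of a diagonal basis is a multiple of a square on the
functionals that map the lattice into `p^d`. -/
theorem formValue_diagonal (hn : Monotone n) (y z : Fin 3 → ℤ_[p])
    (hy : ∀ i, y i = (p : ℤ_[p]) ^ ((∑ j, n j) - n i) * z i) (m : ℕ) :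
    (p : ℤ_[p]) ^ (∑ j, n j) ∣ (p : ℤ_[p]) ^ m * formValue β b (b.constr ℤ_[p] y) ↔
      (p : ℤ_[p]) ^ n 2 ∣
        (p : ℤ_[p]) ^ (n 0 + n 1) * b.repr (β (b 0) (b 1)) 2 * ((p : ℤ_[p]) ^ m * z 2 ^ 2) := by
  have hp0 : (p : ℤ_[p]) ≠ 0 := by exact_mod_cast (Fact.out : p.Prime).ne_zero
  have h01 : n 0 ≤ n 1 := hn (by decide)
  have h12 : n 1 ≤ n 2 := hn (by decide)
  set d := ∑ j, n j with hd
  rw [Fin.sum_univ_three] at hd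
  -- The exponent `(d - n i) + (d - n j)` is at least `d` exactly when `n i + n j ≤ d`, which can
  -- fail only for `i = j = 2`. Thus only the term in `y 2 ^ 2` survives modulo `p^d`.
  have hyy : ∀ i j, ¬ (i = 2 ∧ j = 2) → (p : ℤ_[p]) ^ d ∣ y i * y j := by
    intro i j hij
    have hi : n i ≤ n 2 := hn (by omega)
    have hj : n j ≤ n 2 := hn (by omega)
    have : n i + n j ≤ n 1 + n 2 := by
      by_cases hi2 : i = 2
      · have : n j ≤ n 1 := hn (by omega)
        omega
      · have : n i ≤ n 1 := hn (by omega)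
        omega
    rw [hy, hy]
    refine dvd_trans (pow_dvd_pow _ (show d ≤ (d - n i) + (d - n j) by omega)) ?_
    rw [pow_add]
    exact mul_dvd_mul (dvd_mul_right _ _) (dvd_mul_right _ _)
  have hc : ∀ v, b.constr ℤ_[p] y v = b.repr v 0 * y 0 + b.repr v 1 * y 1 + b.repr v 2 * y 2 := by
    intro v
    rw [Module.Basis.constr_apply_fintype, Fin.sum_univ_three]
    rfl
  have hsub : (p : ℤ_[p]) ^ d ∣ formValue β b (b.constr ℤ_[p] y) -
      b.repr (β (b 0) (b 1)) 2 * (y 2 * y 2) := by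
    have : formValue β b (b.constr ℤ_[p] y) - b.repr (β (b 0) (b 1)) 2 * (y 2 * y 2) =
        b.repr (β (b 1) (b 2)) 0 * (y 0 * y 0) + b.repr (β (b 1) (b 2)) 1 * (y 1 * y 0)
        + b.repr (β (b 1) (b 2)) 2 * (y 2 * y 0) - b.repr (β (b 0) (b 2)) 0 * (y 0 * y 1)
        - b.repr (β (b 0) (b 2)) 1 * (y 1 * y 1) - b.repr (β (b 0) (b 2)) 2 * (y 2 * y 1)
        + b.repr (β (b 0) (b 1)) 0 * (y 0 * y 2) + b.repr (β (b 0) (b 1)) 1 * (y 1 * y 2) := by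
      simp only [formValue, Module.Basis.constr_basis]
      simp only [hc]
      ring
    rw [this]
    have hm : ∀ (i j : Fin 3) (c : ℤ_[p]), ¬ (i = 2 ∧ j = 2) →
        (p : ℤ_[p]) ^ d ∣ c * (y i * y j) := fun i j c hij => Dvd.dvd.mul_left (hyy i j hij) c
    refine dvd_add (dvd_add (dvd_sub (dvd_sub (dvd_sub (dvd_add (dvd_add ?_ ?_) ?_) ?_) ?_) ?_)
      ?_) ?_ <;> exact hm _ _ _ (by decide)
  have hsub' : (p : ℤ_[p]) ^ d ∣ (p : ℤ_[p]) ^ m * formValue β b (b.constr ℤ_[p] y) -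
      (p : ℤ_[p]) ^ m * (b.repr (β (b 0) (b 1)) 2 * (y 2 * y 2)) := by
    rw [← mul_sub]
    exact Dvd.dvd.mul_left hsub _
  rw [dvd_iff_dvd_of_dvd_sub hsub']
  have h2 : d - n 2 = n 0 + n 1 := by omega
  have hd' : d = (n 0 + n 1) + n 2 := by omega
  rw [hy 2, h2, hd', pow_add _ (n 0 + n 1) (n 2),
    show (p : ℤ_[p]) ^ m * (b.repr (β (b 0) (b 1)) 2 *
      ((p : ℤ_[p]) ^ (n 0 + n 1) * z 2 * ((p : ℤ_[p]) ^ (n 0 + n 1) * z 2))) =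
      (p : ℤ_[p]) ^ (n 0 + n 1) * ((p : ℤ_[p]) ^ (n 0 + n 1) * b.repr (β (b 0) (b 1)) 2 *
        ((p : ℤ_[p]) ^ m * z 2 ^ 2)) by ring]
  exact mul_dvd_mul_iff_left (pow_ne_zero _ hp0)

/-- Solutions of `p^N ∣ κ z²` form an ideal. -/
theorem exists_dvd_mul_sq_iff (κ : ℤ_[p]) (N : ℕ) :
    ∃ j : ℕ, ∀ z : ℤ_[p], (p : ℤ_[p]) ^ N ∣ κ * z ^ 2 ↔ (p : ℤ_[p]) ^ j ∣ z := by
  have hp0 : (p : ℤ_[p]) ≠ 0 := by exact_mod_cast (Fact.out : p.Prime).ne_zero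
  classical
  -- The condition depends only on the valuation of `z`, monotonically; the exponent sought is the
  -- least admissible valuation.
  have hex : ∃ j : ℕ, (p : ℤ_[p]) ^ N ∣ κ * ((p : ℤ_[p]) ^ j) ^ 2 :=
    ⟨N, Dvd.dvd.mul_left (dvd_pow_self _ two_ne_zero) _⟩
  refine ⟨Nat.find hex, fun z => ⟨fun h => ?_, fun ⟨w, hw⟩ => ?_⟩⟩
  · by_cases hz : z = 0
    · subst hz; exact dvd_zero _
    obtain ⟨j, u, rfl⟩ := exists_eq_pow_mul_unit hz
    have : (p : ℤ_[p]) ^ N ∣ κ * ((p : ℤ_[p]) ^ j) ^ 2 := by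
      rw [mul_pow, ← mul_assoc, ← Units.val_pow_eq_pow_val] at h
      exact (Units.dvd_mul_right (u := u ^ 2)).1 h
    exact Dvd.dvd.mul_right (pow_dvd_pow _ (Nat.find_min' hex this)) _
  · rw [hw, mul_pow, ← mul_assoc]
    exact Dvd.dvd.mul_right (Nat.find_spec hex) _

end DiagonalLattice

/-! ### Detecting subalgebras by volumes of sets of functionals. -/

section LocalVolume

variable {p : ℕ} [Fact p.Prime]
variable {L : Type*} [AddCommGroup L] [Module ℤ_[p] L]
variable {β : L →ₗ[ℤ_[p]] L →ₗ[ℤ_[p]] L}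

/-- The points `x` whose functional `e_i ↦ x_i` maps `Λ` into `p^d` and with `p^d ∤ p^m f_e(x)`. -/
def badSet (β : L →ₗ[ℤ_[p]] L →ₗ[ℤ_[p]] L) (e : Module.Basis (Fin 3) ℤ_[p] L)
    (Λ : Submodule ℤ_[p] L) (d m : ℕ) : Set (Fin 3 → ℤ_[p]) :=
  {x | (∀ y ∈ Λ, (p : ℤ_[p]) ^ d ∣ e.constr ℤ_[p] x y) ∧
    ¬ (p : ℤ_[p]) ^ d ∣ (p : ℤ_[p]) ^ m * MvPolynomial.eval x (structureForm β e)}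

theorem formValue_basis_change (hβ : ∀ x y : L, β x y = -β y x)
    (e b : Module.Basis (Fin 3) ℤ_[p] L) :
    ∃ u : ℤ_[p]ˣ, ∀ φ, formValue β b φ = u * formValue β e φ := by
  have : Module.Free ℤ_[p] L := Module.Free.of_basis b
  have hu : IsUnit (e.toMatrix b).transpose.det := by
    rw [Matrix.det_transpose, ← Module.Basis.det_apply]
    exact e.isUnit_det b
  obtain ⟨u, hu⟩ := hu
  refine ⟨u, fun φ => ?_⟩
  rw [hu]
  refine formValue_change hβ e b _ (fun i => ?_) φ
  exact (e.sum_toMatrix_smul_self b i).symm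

theorem functional_dvd_iff {b : Module.Basis (Fin 3) ℤ_[p] L} {n : Fin 3 → ℕ}
    {Λ : Submodule ℤ_[p] L} (h : ∀ x, x ∈ Λ ↔ ∀ i, (p : ℤ_[p]) ^ n i ∣ b.repr x i)
    (φ : L →ₗ[ℤ_[p]] ℤ_[p]) {d : ℕ} (hd : ∀ i, n i ≤ d) :
    (∀ y ∈ Λ, (p : ℤ_[p]) ^ d ∣ φ y) ↔ ∀ i, (p : ℤ_[p]) ^ (d - n i) ∣ φ (b i) := by
  have hp0 : (p : ℤ_[p]) ≠ 0 := by exact_mod_cast (Fact.out : p.Prime).ne_zero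
  constructor
  · intro hφ i
    have h1 := hφ _ (smul_basis_mem_of_diagonal h i)
    rw [map_smul, smul_eq_mul, ← Nat.add_sub_of_le (hd i), pow_add] at h1
    simpa using (mul_dvd_mul_iff_left (pow_ne_zero _ hp0)).1 h1
  · intro hφ y hy
    rw [← b.sum_repr y, map_sum]
    refine Finset.dvd_sum fun i _ => ?_
    rw [map_smul, smul_eq_mul, ← Nat.add_sub_of_le (hd i), pow_add]
    exact mul_dvd_mul ((h y).1 hy i) (by simpa using hφ i)

/-- In coordinates dual to `b`, the functionals sending `Λ` into `p^d` form the box with exponents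
`d - n i`, of total `3d - d = 2d`. Those with `p^d ∣ p^m f` form the smaller box whose last exponent
is raised by `K`. -/
theorem volume_badSet (hβ : ∀ x y : L, β x y = -β y x) (e : Module.Basis (Fin 3) ℤ_[p] L)
    {b : Module.Basis (Fin 3) ℤ_[p] L} {n : Fin 3 → ℕ} (hn : Monotone n)
    {Λ : Submodule ℤ_[p] L} (h : ∀ x, x ∈ Λ ↔ ∀ i, (p : ℤ_[p]) ^ n i ∣ b.repr x i) (m K : ℕ)
    (hK : ∀ z : ℤ_[p], (p : ℤ_[p]) ^ n 2 ∣ (p : ℤ_[p]) ^ (n 0 + n 1) *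
      b.repr (β (b 0) (b 1)) 2 * ((p : ℤ_[p]) ^ m * z ^ 2) ↔ (p : ℤ_[p]) ^ K ∣ z) :
    (volume : Measure (Fin 3 → ℤ_[p])).real (badSet β e Λ (∑ j, n j) m) =
      ((p : ℝ) ^ (2 * ∑ j, n j))⁻¹ - ((p : ℝ) ^ (2 * (∑ j, n j) + K))⁻¹ := by
  have hp0 : (p : ℤ_[p]) ≠ 0 := by exact_mod_cast (Fact.out : p.Prime).ne_zero
  set d := ∑ j, n j with hd
  have hle : ∀ i, n i ≤ d := fun i => Finset.single_le_sum (fun _ _ => Nat.zero_le _)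
    (Finset.mem_univ i)
  have hd3 : d = n 0 + n 1 + n 2 := by rw [hd, Fin.sum_univ_three]
  let T : (Fin 3 → ℤ_[p]) ≃ₗ[ℤ_[p]] (Fin 3 → ℤ_[p]) :=
    (e.constr ℤ_[p]).trans (b.constr ℤ_[p]).symm
  have hT : ∀ x, b.constr ℤ_[p] (T x) = e.constr ℤ_[p] x := fun x =>
    (b.constr ℤ_[p]).apply_symm_apply _
  have hTi : ∀ x i, T x i = e.constr ℤ_[p] x (b i) := fun x i => by
    rw [← hT, Module.Basis.constr_basis]
  let k : ℕ → Fin 3 → ℕ := fun j => ![d - n 0, d - n 1, d - n 2 + j]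
  let B : ℕ → Set (Fin 3 → ℤ_[p]) := fun j => {y | ∀ i, (p : ℤ_[p]) ^ k j i ∣ y i}
  have hk0 : ∀ i, k 0 i = d - n i := by
    intro i; fin_cases i <;> rfl
  have hBm : ∀ j, MeasurableSet (B j) := by
    intro j
    have : B j = ⋂ i, {y | (p : ℤ_[p]) ^ k j i ∣ y i} := by ext; simp [B]
    rw [this]
    exact MeasurableSet.iInter fun i => measurableSet_setOf_dvd (continuous_apply i) _
  have hvol : ∀ j, (volume : Measure (Fin 3 → ℤ_[p])).real (B j) =
      ((p : ℝ) ^ (2 * d + j))⁻¹ := by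
    intro j
    rw [volume_box, Fin.sum_univ_three]
    congr 2
    simp only [k, Matrix.cons_val]
    omega
  have hsub : B K ⊆ B 0 := by
    intro y hy i
    refine dvd_trans (pow_dvd_pow _ ?_) (hy i)
    fin_cases i <;> simp [k]
  obtain ⟨u, hu⟩ := formValue_basis_change hβ e b
  have hset : badSet β e Λ d m = T ⁻¹' (B 0 \ B K) := by
    ext x
    rw [Set.mem_preimage, Set.mem_sdiff]
    have h0 : (∀ y ∈ Λ, (p : ℤ_[p]) ^ d ∣ e.constr ℤ_[p] x y) ↔ T x ∈ B 0 := by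
      rw [functional_dvd_iff h _ hle]
      simp only [← hTi, B, ← hk0]
      rfl
    refine Iff.trans (and_congr_left fun _ => h0) (and_congr_right fun hx => not_congr ?_)
    choose z hz using fun i => hk0 i ▸ hx i
    have h1 : (p : ℤ_[p]) ^ m * formValue β b (b.constr ℤ_[p] (T x)) =
        u * ((p : ℤ_[p]) ^ m * MvPolynomial.eval x (structureForm β e)) := by
      rw [hu, hT, eval_structureForm]; ring
    rw [← Units.dvd_mul_left (u := u), ← h1, formValue_diagonal hn (T x) z hz m, hK]
    constructor
    · intro hz2 i
      fin_cases i
      · exact hx 0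
      · exact hx 1
      · change (p : ℤ_[p]) ^ (d - n 2 + K) ∣ T x 2
        rw [hz 2, pow_add]
        exact mul_dvd_mul_left _ hz2
    · intro hy
      have hy2 : (p : ℤ_[p]) ^ (d - n 2 + K) ∣ T x 2 := hy 2
      rw [hz 2, pow_add] at hy2
      exact (mul_dvd_mul_iff_left (pow_ne_zero _ hp0)).1 hy2
  rw [hset, measureReal_def, (measurePreserving_linearEquiv T).measure_preimage
    ((hBm 0).diff (hBm K)).nullMeasurableSet, ← measureReal_def,
    measureReal_sdiff hsub (hBm K), hvol, hvol, add_zero]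

-- With `j` the exponent for `m = 0`, the left side is `p^(-2d)` times `(1 - p^(-j)) - p⁻¹ (1 -
-- p^(-(j-1)))`, where `j - 1` is truncated. For `j ≥ 1` the dependence on `j` cancels; `j = 0` is
-- the closed case.
open Classical in
theorem badSet_volume_identity (hβ : ∀ x y : L, β x y = -β y x)
    (e : Module.Basis (Fin 3) ℤ_[p] L) {Λ : Submodule ℤ_[p] L} {d : ℕ}
    (hΛ : latticeIndex Λ = p ^ d) :
    (volume : Measure (Fin 3 → ℤ_[p])).real (badSet β e Λ d 0) -
        (p : ℝ)⁻¹ * (volume : Measure (Fin 3 → ℤ_[p])).real (badSet β e Λ d 2) =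
      if ∀ x ∈ Λ, ∀ y ∈ Λ, β x y ∈ Λ then 0 else (1 - (p : ℝ)⁻¹) * ((p : ℝ) ^ (2 * d))⁻¹ := by
  have hp : p.Prime := Fact.out
  have hp0 : (p : ℤ_[p]) ≠ 0 := by exact_mod_cast hp.ne_zero
  have hpr : (p : ℝ) ≠ 0 := by exact_mod_cast hp.ne_zero
  obtain ⟨b, n, hn, h⟩ := exists_diagonal_basis e Λ (by rw [hΛ]; exact pow_ne_zero _ hp.ne_zero)
  have hd : d = ∑ j, n j := by
    have := latticeIndex_of_diagonal b n Λ h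
    rw [hΛ] at this
    exact Nat.pow_right_injective hp.two_le this
  subst hd
  obtain ⟨j, hj⟩ := exists_dvd_mul_sq_iff
    ((p : ℤ_[p]) ^ (n 0 + n 1) * b.repr (β (b 0) (b 1)) 2) (n 2)
  have h0 := volume_badSet hβ e hn h 0 j (by simpa using hj)
  -- Since `p^2 z^2 = (p z)^2`, the choice `m = 2` lowers the exponent by exactly one, which is why
  -- `m = 1` is not used.
  have h2 := volume_badSet hβ e hn h 2 (j - 1) (by
    intro z
    rw [← mul_pow, hj]
    rcases j with _ | j
    · simp
    · rw [pow_succ', Nat.add_sub_cancel]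
      exact mul_dvd_mul_iff_left hp0)
  have hcl : (∀ x ∈ Λ, ∀ y ∈ Λ, β x y ∈ Λ) ↔ j = 0 := by
    rw [closed_iff_of_diagonal hβ hn h]
    have h1 := hj 1
    rw [one_pow, mul_one] at h1
    rw [h1]
    constructor
    · intro hdvd
      by_contra hne
      have : (p : ℤ_[p]) ∣ 1 := dvd_trans (dvd_pow_self _ hne) hdvd
      exact PadicInt.prime_p.not_isUnit (isUnit_of_dvd_one this)
    · rintro rfl
      simp
  rw [h0, h2]
  simp only [hcl]
  rcases j with _ | j
  · simp
  · rw [if_neg (Nat.succ_ne_zero j), Nat.add_sub_cancel, pow_add, pow_add, pow_succ]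
    field_simp
    ring

end LocalVolume

/-- Double counting: exchange the finite sum with the integral of the indicator functions. -/
theorem sum_measureReal_of_constant_multiplicity {α ι : Type*} [MeasurableSpace α]
    {μ : Measure α} [IsFiniteMeasure μ] [Fintype ι] (S : ι → Set α) (E : Set α) (k : ℕ)
    (hS : ∀ i, MeasurableSet (S i)) (hE : MeasurableSet E) (hsub : ∀ i, S i ⊆ E)
    (hk : ∀ x ∈ E, Nat.card {i // x ∈ S i} = k) :
    ∑ i, μ.real (S i) = k * μ.real E := by
  classical
  have h1 : ∀ A, MeasurableSet A → Integrable (A.indicator (1 : α → ℝ)) μ := fun A hA =>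
    (integrable_const (1 : ℝ)).indicator hA
  calc ∑ i, μ.real (S i) = ∑ i, ∫ x, (S i).indicator (1 : α → ℝ) x ∂μ :=
        Finset.sum_congr rfl fun i _ => (integral_indicator_one (hS i)).symm
    _ = ∫ x, ∑ i, (S i).indicator (1 : α → ℝ) x ∂μ :=
        (integral_finsetSum _ fun i _ => h1 _ (hS i)).symm
    _ = ∫ x, k * E.indicator (1 : α → ℝ) x ∂μ := by
        refine integral_congr_ae (Filter.Eventually.of_forall fun x => ?_)
        simp only [Set.indicator_apply, Pi.one_apply]
        rw [Finset.sum_boole]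
        by_cases hx : x ∈ E
        · rw [if_pos hx, mul_one, ← hk x hx, Nat.card_eq_fintype_card, Fintype.card_subtype]
        · rw [if_neg hx, mul_zero, Finset.filter_false_of_mem fun i _ hi => hx (hsub i hi)]
          simp
    _ = k * μ.real E := by rw [integral_const_mul, integral_indicator_one hE]

/-! ### Exchanging the sum over lattices with the integral over functionals. -/

section Swap

variable {p : ℕ} [Fact p.Prime]
variable {L : Type*} [AddCommGroup L] [Module ℤ_[p] L]
variable {β : L →ₗ[ℤ_[p]] L →ₗ[ℤ_[p]] L}

theorem pow_dvd_pow_mul_iff (d k : ℕ) (w : ℤ_[p]) :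
    (p : ℤ_[p]) ^ d ∣ (p : ℤ_[p]) ^ k * w ↔ (p : ℤ_[p]) ^ (d - k) ∣ w := by
  have hp0 : (p : ℤ_[p]) ≠ 0 := by exact_mod_cast (Fact.out : p.Prime).ne_zero
  rcases le_total d k with h | h
  · rw [Nat.sub_eq_zero_of_le h, pow_zero]
    exact iff_of_true (Dvd.dvd.mul_right (pow_dvd_pow _ h) _) (one_dvd _)
  · conv_lhs => rw [← Nat.add_sub_of_le h, pow_add]
    exact mul_dvd_mul_iff_left (pow_ne_zero _ hp0)

theorem eval_structureForm_smul (e : Module.Basis (Fin 3) ℤ_[p] L) (a : ℤ_[p])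
    (x : Fin 3 → ℤ_[p]) :
    MvPolynomial.eval (a • x) (structureForm β e) =
      a ^ 2 * MvPolynomial.eval x (structureForm β e) := by
  simp only [eval_structureForm, formValue, map_smul, LinearMap.smul_apply, smul_eq_mul]
  ring

/-- Points whose coordinates are all divisible by `p^c`. -/
def contentSet (p : ℕ) [Fact p.Prime] (c : ℕ) : Set (Fin 3 → ℤ_[p]) :=
  {x | ∀ i, (p : ℤ_[p]) ^ c ∣ x i}

/-- The volume of the set where a polynomial function is not divisible by `p^d`. -/
noncomputable def nonDivVolume (f : MvPolynomial (Fin 3) ℤ_[p]) (d : ℕ) : ℝ :=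
  (volume : Measure (Fin 3 → ℤ_[p])).real {x | ¬ (p : ℤ_[p]) ^ d ∣ MvPolynomial.eval x f}

theorem continuous_eval (f : MvPolynomial (Fin 3) ℤ_[p]) :
    Continuous fun x : Fin 3 → ℤ_[p] => MvPolynomial.eval x f := MvPolynomial.continuous_eval f

theorem measurableSet_contentSet (c : ℕ) : MeasurableSet (contentSet p c) := by
  have : contentSet p c = ⋂ i, {y | (p : ℤ_[p]) ^ c ∣ y i} := by ext; simp [contentSet]
  rw [this]
  exact MeasurableSet.iInter fun i => measurableSet_setOf_dvd (continuous_apply i) _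

theorem measurableSet_not_dvd (f : MvPolynomial (Fin 3) ℤ_[p]) (d m : ℕ) :
    MeasurableSet {x | ¬ (p : ℤ_[p]) ^ d ∣ (p : ℤ_[p]) ^ m * MvPolynomial.eval x f} :=
  (measurableSet_setOf_dvd (continuous_const.mul (continuous_eval f)) d).compl

/-- Substitute `x = p^c z`: the volume scales by `p^(-3c)` and the quadratic form by `p^(2c)`.
Truncated subtraction is right here, because the set becomes empty once `d ≤ 2c + m`. -/
theorem volume_contentSet_inter (e : Module.Basis (Fin 3) ℤ_[p] L) (c d m : ℕ) :
    (volume : Measure (Fin 3 → ℤ_[p])).real (contentSet p c ∩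
      {x | ¬ (p : ℤ_[p]) ^ d ∣ (p : ℤ_[p]) ^ m * MvPolynomial.eval x (structureForm β e)}) =
      ((p : ℝ) ^ (3 * c))⁻¹ * nonDivVolume (structureForm β e) (d - 2 * c - m) := by
  have hset : contentSet p c ∩
      {x | ¬ (p : ℤ_[p]) ^ d ∣ (p : ℤ_[p]) ^ m * MvPolynomial.eval x (structureForm β e)} =
      (fun x => (p : ℤ_[p]) ^ c • x) ''
        {x | ¬ (p : ℤ_[p]) ^ (d - 2 * c - m) ∣ MvPolynomial.eval x (structureForm β e)} := by
    have key : ∀ x, (p : ℤ_[p]) ^ d ∣ (p : ℤ_[p]) ^ m *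
        MvPolynomial.eval ((p : ℤ_[p]) ^ c • x) (structureForm β e) ↔
        (p : ℤ_[p]) ^ (d - 2 * c - m) ∣ MvPolynomial.eval x (structureForm β e) := by
      intro x
      rw [eval_structureForm_smul, pow_dvd_pow_mul_iff, ← pow_mul, pow_dvd_pow_mul_iff,
        mul_comm c 2, Nat.sub_right_comm]
    ext y
    constructor
    · rintro ⟨hy, hy'⟩
      choose x hx using hy
      have hxy : y = (p : ℤ_[p]) ^ c • x := funext hx
      exact ⟨x, fun h => hy' (by rw [hxy]; exact (key x).2 h), hxy.symm⟩
    · rintro ⟨x, hx, rfl⟩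
      exact ⟨fun i => ⟨x i, rfl⟩, fun h => hx ((key x).1 h)⟩
  rw [hset, volume_smul_image]
  rfl

/-- Write `x = p^c z` with some `z i` a unit; then `K` is the kernel of the surjection `z` modulo
`p^(d-c)`. -/
theorem latticeIndex_functional_kernel (e : Module.Basis (Fin 3) ℤ_[p] L) {x : Fin 3 → ℤ_[p]}
    {c d : ℕ} (hx : x ∈ contentSet p c) (hx' : x ∉ contentSet p (c + 1))
    (K : Submodule ℤ_[p] L) (hK : ∀ y, y ∈ K ↔ (p : ℤ_[p]) ^ d ∣ e.constr ℤ_[p] x y) :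
    latticeIndex K = p ^ (d - c) := by
  choose z hz using hx
  have hxz : x = (p : ℤ_[p]) ^ c • z := funext hz
  have hunit : ∃ i, IsUnit (z i) := by
    by_contra hne
    push Not at hne
    refine hx' fun i => ?_
    have : (p : ℤ_[p]) ∣ z i := by
      rw [← PadicInt.norm_lt_one_iff_dvd, ← PadicInt.not_isUnit_iff]
      exact hne i
    rw [hz, pow_succ]
    exact mul_dvd_mul_left _ this
  obtain ⟨i, u, hu⟩ := hunit
  set ψ := e.constr ℤ_[p] z with hψ
  let g : L →+ ZMod (p ^ (d - c)) :=
    (PadicInt.toZModPow (p := p) (d - c)).toAddMonoidHom.comp ψ.toAddMonoidHom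
  have hg : ∀ y, g y = PadicInt.toZModPow (p := p) (d - c) (ψ y) := fun y => rfl
  have hker : K.toAddSubgroup = g.ker := by
    ext y
    rw [Submodule.mem_toAddSubgroup, hK, AddMonoidHom.mem_ker, hg, ← RingHom.mem_ker,
      PadicInt.ker_toZModPow, Ideal.mem_span_singleton, hxz, map_smul, LinearMap.smul_apply,
      smul_eq_mul, pow_dvd_pow_mul_iff]
  have hsurj : g.range = ⊤ := by
    rw [AddMonoidHom.range_eq_top]
    intro w
    obtain ⟨r, rfl⟩ := ZMod.ringHom_surjective (PadicInt.toZModPow (p := p) (d - c)) w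
    refine ⟨(((u⁻¹ : ℤ_[p]ˣ) : ℤ_[p]) * r) • e i, ?_⟩
    rw [hg, map_smul, hψ, Module.Basis.constr_basis, ← hu, smul_eq_mul, mul_right_comm,
      Units.inv_mul, one_mul]
  rw [latticeIndex, hker, AddSubgroup.index_ker, hsurj,
    Nat.card_congr AddSubgroup.topEquiv.toEquiv, Nat.card_zmod]

theorem measurableSet_badSet (e : Module.Basis (Fin 3) ℤ_[p] L) (Λ : Submodule ℤ_[p] L)
    (d m : ℕ) : MeasurableSet (badSet β e Λ d m) := by
  refine MeasurableSet.inter (s₁ := {x | ∀ y ∈ Λ, (p : ℤ_[p]) ^ d ∣ e.constr ℤ_[p] x y}) ?_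
    (measurableSet_not_dvd _ d m)
  have hcl : IsClosed {x | ∀ y ∈ Λ, (p : ℤ_[p]) ^ d ∣ e.constr ℤ_[p] x y} := by
    have : {x | ∀ y ∈ Λ, (p : ℤ_[p]) ^ d ∣ e.constr ℤ_[p] x y} =
        ⋂ y ∈ Λ, {x | ‖e.constr ℤ_[p] x y‖ ≤ (p : ℝ) ^ (-(d : ℤ))} := by
      ext x
      simp only [Set.mem_iInter]
      refine forall₂_congr fun y _ => ?_
      change _ ↔ ‖e.constr ℤ_[p] x y‖ ≤ (p : ℝ) ^ (-(d : ℤ))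
      rw [PadicInt.norm_le_pow_iff_mem_span_pow, Ideal.mem_span_singleton]
    rw [this]
    refine isClosed_biInter fun y _ => isClosed_le (Continuous.norm ?_) continuous_const
    simp only [Module.Basis.constr_apply_fintype]
    exact continuous_finsetSum _ fun i _ => (continuous_apply i).const_smul (e.equivFun y i)
  exact hcl.measurableSet

/-- Stratify by the exact content `p^c` of `x`. The lattices `Λ` having `x` in their set are those
inside the kernel of `x` modulo `p^d`, and their number is constant on each stratum. -/
theorem sum_volume_badSet (e : Module.Basis (Fin 3) ℤ_[p] L) (d m : ℕ)
    [Fintype (LatticeOfIndex p L (p ^ d))] :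
    ∑ Λ : LatticeOfIndex p L (p ^ d),
        (volume : Measure (Fin 3 → ℤ_[p])).real (badSet β e Λ.1 d m) =
      ∑ c ∈ Finset.range d, (latticeCount p 3 c : ℝ) * (((p : ℝ) ^ (3 * c))⁻¹ *
        (nonDivVolume (structureForm β e) (d - 2 * c - m) -
          ((p : ℝ) ^ 3)⁻¹ * nonDivVolume (structureForm β e) (d - 2 * c - m - 2))) := by
  have : Module.Free ℤ_[p] L := Module.Free.of_basis e
  have : Module.Finite ℤ_[p] L := Module.Finite.of_basis e
  have hrank : Module.finrank ℤ_[p] L = 3 := by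
    rw [Module.finrank_eq_card_basis e, Fintype.card_fin]
  set f := structureForm β e with hf
  set D : Set (Fin 3 → ℤ_[p]) :=
    {x | ¬ (p : ℤ_[p]) ^ d ∣ (p : ℤ_[p]) ^ m * MvPolynomial.eval x f} with hD
  have hDm : MeasurableSet D := measurableSet_not_dvd f d m
  have hmono : ∀ {a c : ℕ}, a ≤ c → contentSet p c ⊆ contentSet p a := fun hac x hx i =>
    dvd_trans (pow_dvd_pow _ hac) (hx i)
  set A : ℕ → Set (Fin 3 → ℤ_[p]) := fun c => contentSet p c \ contentSet p (c + 1) with hA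
  have hAm : ∀ c, MeasurableSet (A c) := fun c =>
    (measurableSet_contentSet c).diff (measurableSet_contentSet (c + 1))
  have hAdisj : ∀ a c, a < c → Disjoint (A a) (A c) := by
    intro a c hac
    rw [Set.disjoint_left]
    exact fun x hx hx' => hx.2 (hmono hac hx'.1)
  -- Content at least `p^d` forces `p^(2d) ∣ f(x)`, so such points are not in `D` and only `c < d`
  -- occurs.
  have hcover : ∀ x ∈ D, ∃ c ∈ Finset.range d, x ∈ A c := by
    intro x hx
    classical
    have hnot : x ∉ contentSet p d := by
      intro h
      apply hx
      choose z hz using h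
      have hxz : x = (p : ℤ_[p]) ^ d • z := funext hz
      rw [hxz, hf, eval_structureForm_smul, sq, mul_assoc]
      exact Dvd.dvd.mul_left (dvd_mul_right _ _) _
    have hex : ∃ k, x ∉ contentSet p k := ⟨d, hnot⟩
    have h0 : Nat.find hex ≠ 0 := by
      intro h
      have := Nat.find_spec hex
      rw [h] at this
      exact this fun i => by simp
    have hle := Nat.find_min' hex hnot
    refine ⟨Nat.find hex - 1, Finset.mem_range.2 (by omega), ?_, ?_⟩
    · exact not_not.1 (Nat.find_min hex (show Nat.find hex - 1 < Nat.find hex by omega))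
    · rw [Nat.sub_add_cancel (Nat.one_le_iff_ne_zero.2 h0)]
      exact Nat.find_spec hex
  have hsplit : ∀ Λ : LatticeOfIndex p L (p ^ d),
      (volume : Measure (Fin 3 → ℤ_[p])).real (badSet β e Λ.1 d m) =
      ∑ c ∈ Finset.range d,
        (volume : Measure (Fin 3 → ℤ_[p])).real (badSet β e Λ.1 d m ∩ A c) := by
    intro Λ
    rw [← measureReal_biUnion_finset]
    · congr 1
      ext x
      simp only [Set.mem_iUnion, Set.mem_inter_iff]
      constructor
      · intro hx
        obtain ⟨c, hc, hxc⟩ := hcover x hx.2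
        exact ⟨c, hc, hx, hxc⟩
      · rintro ⟨c, hc, hx, -⟩
        exact hx
    · intro a _ c _ hac
      refine Disjoint.mono Set.inter_subset_right Set.inter_subset_right ?_
      rcases lt_or_gt_of_ne hac with h | h
      · exact hAdisj _ _ h
      · exact (hAdisj _ _ h).symm
    · exact fun c _ => (measurableSet_badSet e Λ.1 d m).inter (hAm c)
  rw [Finset.sum_congr rfl fun Λ _ => hsplit Λ, Finset.sum_comm]
  refine Finset.sum_congr rfl fun c hc => ?_
  have hcd : c < d := Finset.mem_range.1 hc
  have hcount := sum_measureReal_of_constant_multiplicity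
    (μ := (volume : Measure (Fin 3 → ℤ_[p])))
    (fun Λ : LatticeOfIndex p L (p ^ d) => badSet β e Λ.1 d m ∩ A c) (A c ∩ D)
    (latticeCount p 3 c) (fun Λ => (measurableSet_badSet e Λ.1 d m).inter (hAm c))
    ((hAm c).inter hDm) (fun Λ x hx => ⟨hx.2, hx.1.2⟩) (by
      rintro x ⟨hxA, hxD⟩
      let K : Submodule ℤ_[p] L := Submodule.comap (e.constr ℤ_[p] x)
        (Ideal.span {(p : ℤ_[p]) ^ d})
      have hK : ∀ y, y ∈ K ↔ (p : ℤ_[p]) ^ d ∣ e.constr ℤ_[p] x y := fun y => by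
        rw [Submodule.mem_comap, Ideal.mem_span_singleton]
      have hidx := latticeIndex_functional_kernel e hxA.1 hxA.2 K hK
      have hcardK := card_latticeOfIndex_le hcd.le hidx
      rw [hrank] at hcardK
      rw [← hcardK]
      refine Nat.card_congr (Equiv.subtypeEquivRight fun Λ => ?_)
      constructor
      · intro h y hy
        exact (hK y).2 (h.1.1 y hy)
      · intro h
        exact ⟨⟨fun y hy => (hK y).1 (h hy), hxD⟩, hxA⟩)
  rw [hcount]
  congr 1
  have hdiff : A c ∩ D = (contentSet p c ∩ D) \ (contentSet p (c + 1) ∩ D) := by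
    ext x
    simp only [hA, Set.mem_inter_iff, Set.mem_sdiff]
    tauto
  rw [hdiff, measureReal_sdiff (Set.inter_subset_inter_left _ (hmono (Nat.le_succ c)))
    ((measurableSet_contentSet _).inter hDm), volume_contentSet_inter, volume_contentSet_inter,
    show d - 2 * (c + 1) - m = d - 2 * c - m - 2 by omega, Nat.mul_succ, pow_add, mul_inv]
  ring

open Classical in
/-- The number of sublattices of index `p^d` that are not subalgebras. -/
theorem card_not_closed (hβ : ∀ x y : L, β x y = -β y x) (e : Module.Basis (Fin 3) ℤ_[p] L)
    (d : ℕ) :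
    (1 - (p : ℝ)⁻¹) * ((p : ℝ) ^ (2 * d))⁻¹ *
      (Nat.card {Λ : LatticeOfIndex p L (p ^ d) // ¬ ∀ x ∈ Λ.1, ∀ y ∈ Λ.1, β x y ∈ Λ.1} : ℝ) =
    ∑ c ∈ Finset.range d, ((latticeCount p 3 c : ℝ) * ((p : ℝ) ^ (3 * c))⁻¹) *
      (nonDivVolume (structureForm β e) (d - 2 * c) -
        ((p : ℝ)⁻¹ + ((p : ℝ) ^ 3)⁻¹) * nonDivVolume (structureForm β e) (d - 2 * c - 2) +
        ((p : ℝ) ^ 4)⁻¹ * nonDivVolume (structureForm β e) (d - 2 * c - 4)) := by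
  have : Module.Free ℤ_[p] L := Module.Free.of_basis e
  have : Module.Finite ℤ_[p] L := Module.Finite.of_basis e
  have := Fintype.ofFinite (LatticeOfIndex p L (p ^ d))
  have h := Finset.sum_congr (rfl : (Finset.univ : Finset (LatticeOfIndex p L (p ^ d))) = _)
    fun Λ _ => badSet_volume_identity hβ e Λ.2
  -- Combining `m = 0` and `m = 2` composes two difference operators: with `S` the shift by two, the
  -- bracket is `(1 - p⁻¹ S)(1 - p⁻³ S)` applied to the volumes.
  rw [Finset.sum_sub_distrib, ← Finset.mul_sum, sum_volume_badSet, sum_volume_badSet,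
    Finset.mul_sum, ← Finset.sum_sub_distrib] at h
  have hcard : (∑ Λ : LatticeOfIndex p L (p ^ d), if ∀ x ∈ Λ.1, ∀ y ∈ Λ.1, β x y ∈ Λ.1 then
      (0 : ℝ) else (1 - (p : ℝ)⁻¹) * ((p : ℝ) ^ (2 * d))⁻¹) =
      (1 - (p : ℝ)⁻¹) * ((p : ℝ) ^ (2 * d))⁻¹ * (Nat.card {Λ : LatticeOfIndex p L (p ^ d) //
        ¬ ∀ x ∈ Λ.1, ∀ y ∈ Λ.1, β x y ∈ Λ.1} : ℝ) := by
    rw [Nat.card_eq_fintype_card, Fintype.card_subtype, ← Finset.sum_boole, Finset.mul_sum]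
    refine Finset.sum_congr rfl fun Λ _ => ?_
    split_ifs <;> simp
  rw [← hcard, ← h]
  refine Finset.sum_congr rfl fun c _ => ?_
  rw [Nat.sub_zero, Nat.sub_sub (d - 2 * c) 2 2, show (p : ℝ) ^ 4 = p * p ^ 3 by ring, mul_inv]
  ring

end Swap

/-! ### Power series manipulations. -/

section Series

/-- A Cauchy product reindexed by `d = 2c + e`. Terms with `d < 2c` vanish because truncated
subtraction meets `W 0 = 0`; for the same reason stopping at `c < d` loses nothing. -/
theorem hasSum_dilated_convolution {α W : ℕ → ℂ} {q : ℂ} (hW0 : W 0 = 0)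
    (hα : Summable fun c => ‖α c * q ^ (2 * c)‖) (hW : Summable fun e => ‖W e * q ^ e‖) :
    HasSum (fun d => (∑ c ∈ Finset.range d, α c * W (d - 2 * c)) * q ^ d)
      ((∑' c, α c * q ^ (2 * c)) * ∑' e, W e * q ^ e) := by
  let j : ℕ × ℕ → ℕ × ℕ := fun x => (2 * x.1 + x.2, x.1)
  have hj : Function.Injective j := by
    rintro ⟨a, b⟩ ⟨a', b'⟩ h
    simp only [j, Prod.mk.injEq] at h ⊢
    omega
  let F : ℕ × ℕ → ℂ := fun x => α x.2 * W (x.1 - 2 * x.2) * q ^ x.1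
  have hF0 : ∀ x, x ∉ Set.range j → F x = 0 := by
    rintro ⟨d, c⟩ hx
    have : d < 2 * c := by
      by_contra h
      exact hx ⟨(c, d - 2 * c), Prod.ext (show 2 * c + (d - 2 * c) = d by omega) rfl⟩
    simp only [F]
    rw [Nat.sub_eq_zero_of_le this.le, hW0]
    ring
  have hFj : ∀ x, F (j x) = (α x.1 * q ^ (2 * x.1)) * (W x.2 * q ^ x.2) := by
    rintro ⟨c, e⟩
    simp only [F, j, Nat.add_sub_cancel_left, pow_add]
    ring
  have h1 : HasSum (F ∘ j) ((∑' c, α c * q ^ (2 * c)) * ∑' e, W e * q ^ e) := by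
    have hs := summable_mul_of_summable_norm hα hW
    rw [tsum_mul_tsum_of_summable_norm hα hW]
    exact hs.hasSum.congr_fun hFj
  have h2 : HasSum F _ := (hj.hasSum_iff hF0).1 h1
  refine h2.prod_fiberwise fun d => ?_
  have h3 : ∀ c, c ∉ Finset.range d → F (d, c) = 0 := by
    intro c hc
    have : d ≤ c := by simpa using hc
    simp only [F]
    rw [Nat.sub_eq_zero_of_le (by omega), hW0]
    ring
  have h4 : HasSum (fun c => F (d, c)) (∑ c ∈ Finset.range d, F (d, c)) :=
    hasSum_sum_of_ne_finset_zero h3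
  rw [Finset.sum_mul]
  exact h4

theorem summable_bounded_mul_pow {Y : ℕ → ℂ} {C : ℝ} (hY : ∀ d, ‖Y d‖ ≤ C) {q : ℂ} (hq : ‖q‖ < 1) :
    Summable fun d => ‖Y d * q ^ d‖ := by
  refine Summable.of_nonneg_of_le (fun _ => norm_nonneg _) (fun d => ?_)
    ((summable_geometric_of_lt_one (norm_nonneg q) hq).mul_left C)
  rw [norm_mul, norm_pow]
  exact mul_le_mul_of_nonneg_right (hY d) (pow_nonneg (norm_nonneg _) _)

theorem hasSum_shift {Y : ℕ → ℂ} {q : ℂ} (hY0 : Y 0 = 0) (k : ℕ)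
    (hs : Summable fun d => Y d * q ^ d) :
    HasSum (fun d => Y (d - k) * q ^ d) (q ^ k * ∑' d, Y d * q ^ d) := by
  rw [← hasSum_nat_add_iff' k]
  have h0 : ∑ i ∈ Finset.range k, Y (i - k) * q ^ i = 0 :=
    Finset.sum_eq_zero fun i hi => by
      rw [Nat.sub_eq_zero_of_le (Finset.mem_range.1 hi).le, hY0, zero_mul]
  rw [h0, sub_zero]
  refine (hs.hasSum.mul_left (q ^ k)).congr_fun fun d => ?_
  rw [Nat.add_sub_cancel, pow_add]
  ring

theorem ofReal_pow_cpow {x : ℝ} (hx : 0 ≤ x) (w : ℂ) (n : ℕ) :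
    ((x ^ n : ℝ) : ℂ) ^ w = ((x : ℂ) ^ w) ^ n := by
  induction n with
  | zero => simp
  | succ n ih =>
    rw [pow_succ, pow_succ, ← ih, Complex.ofReal_mul,
      Complex.mul_cpow_ofReal_nonneg (pow_nonneg hx n) hx]

theorem natCast_pow_cpow (p n : ℕ) (w : ℂ) :
    (((p ^ n : ℕ)) : ℂ) ^ w = ((p : ℂ) ^ w) ^ n := by
  have := ofReal_pow_cpow (Nat.cast_nonneg p) w n
  push_cast at this ⊢
  exact this

end Series

/-! ### Igusa's integral as a generating series. -/

section Igusa

variable {p : ℕ} [Fact p.Prime]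

theorem norm_cpow_neg_lt_one {w : ℂ} (hw : 0 < w.re) : ‖(p : ℂ) ^ (-w)‖ < 1 := by
  have hp : p.Prime := Fact.out
  rw [Complex.norm_natCast_cpow_of_pos hp.pos]
  exact Real.rpow_lt_one_of_one_lt_of_neg (by exact_mod_cast hp.one_lt) (by simpa using hw)

theorem nonDivVolume_zero (f : MvPolynomial (Fin 3) ℤ_[p]) : nonDivVolume f 0 = 0 := by
  simp [nonDivVolume]

theorem nonDivVolume_bound (f : MvPolynomial (Fin 3) ℤ_[p]) (d : ℕ) :
    ‖(nonDivVolume f d : ℂ)‖ ≤ 1 := by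
  rw [Complex.norm_real, nonDivVolume, Real.norm_of_nonneg measureReal_nonneg]
  exact measureReal_le_one

theorem integrable_igusaIntegrand (f : MvPolynomial (Fin 3) ℤ_[p]) {w : ℂ} (hw : 0 < w.re) :
    Integrable (igusaIntegrand f w) := by
  have hm : Measurable (igusaIntegrand f w) :=
    (Complex.measurable_ofReal.comp (continuous_eval f).norm.measurable).pow_const w
  refine Integrable.of_bound hm.aestronglyMeasurable 1
    (Filter.Eventually.of_forall fun x => ?_)
  rw [igusaIntegrand, Complex.norm_cpow_eq_rpow_re_of_nonneg (norm_nonneg _) hw.ne']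
  exact Real.rpow_le_one (norm_nonneg _) (PadicInt.norm_le_one _) hw.le

theorem igusaIntegrand_of_pow_mul_unit (f : MvPolynomial (Fin 3) ℤ_[p]) (w : ℂ)
    {x : Fin 3 → ℤ_[p]} {v : ℕ} {u : ℤ_[p]ˣ}
    (hx : MvPolynomial.eval x f = (p : ℤ_[p]) ^ v * u) :
    igusaIntegrand f w x = ((p : ℂ) ^ (-w)) ^ v := by
  have h1 : ‖MvPolynomial.eval x f‖ = ((p : ℝ)⁻¹) ^ v := by
    rw [hx, norm_mul, norm_pow, PadicInt.norm_p, PadicInt.norm_units, mul_one]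
  rw [igusaIntegrand, h1, ofReal_pow_cpow (by positivity), Complex.cpow_neg]
  congr 1
  rw [Complex.ofReal_inv, Complex.ofReal_natCast, Complex.inv_cpow _ _ (by
    rw [Complex.natCast_arg]; exact Real.pi_pos.ne)]

/-- Igusa's zeta function as a power series in `p^{-w}`. -/
theorem mul_igusaZeta (f : MvPolynomial (Fin 3) ℤ_[p]) {w : ℂ} (hw : 0 < w.re) :
    (p : ℂ) ^ (-w) * igusaZeta f w =
      (1 - (p : ℂ) ^ (-w)) * ∑' d, (nonDivVolume f d : ℂ) * ((p : ℂ) ^ (-w)) ^ d := by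
  have hp0 : (p : ℤ_[p]) ≠ 0 := by exact_mod_cast (Fact.out : p.Prime).ne_zero
  set q := (p : ℂ) ^ (-w) with hq
  have hq1 : ‖q‖ < 1 := norm_cpow_neg_lt_one hw
  have hq1' : 1 - q ≠ 0 := by
    rw [sub_ne_zero]
    rintro h
    rw [← h, norm_one] at hq1
    exact lt_irrefl _ hq1
  let D : ℕ → Set (Fin 3 → ℤ_[p]) := fun d => {x | ¬ (p : ℤ_[p]) ^ d ∣ MvPolynomial.eval x f}
  have hD : ∀ d, MeasurableSet (D d) := fun d => by simpa [D] using measurableSet_not_dvd f d 0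
  let F : ℕ → (Fin 3 → ℤ_[p]) → ℂ := fun d => (D d).indicator fun _ => q ^ d
  have hFi : ∀ d, Integrable (F d) := fun d => (integrable_const _).indicator (hD d)
  have hFint : ∀ d, ∫ x, F d x = (nonDivVolume f d : ℂ) * q ^ d := by
    intro d
    rw [integral_indicator_const _ (hD d), Complex.real_smul]
    rfl
  have hFnorm : ∀ d, ∫ x, ‖F d x‖ = ‖(nonDivVolume f d : ℂ) * q ^ d‖ := by
    intro d
    have : ∀ x, ‖F d x‖ = (D d).indicator (fun _ => ‖q ^ d‖) x := fun x =>
      norm_indicator_eq_indicator_norm _ _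
    simp only [this]
    rw [integral_indicator_const _ (hD d), norm_mul, Complex.norm_real, smul_eq_mul,
      nonDivVolume, Real.norm_of_nonneg measureReal_nonneg]
  -- If `f(x)` has valuation `v`, the sum is the geometric tail over `d > v`, namely `q^(v+1) / (1 -
  -- q)`. On the zero set of `f` both sides vanish, since `w ≠ 0`.
  have hpt : ∀ x, ∑' d, F d x = q * (1 - q)⁻¹ * igusaIntegrand f w x := by
    intro x
    by_cases hx : MvPolynomial.eval x f = 0
    · have h0 : ∀ d, F d x = 0 := fun d => Set.indicator_of_notMem (by simp [D, hx]) _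
      have hw0 : w ≠ 0 := by rintro rfl; simp at hw
      simp [h0, igusaIntegrand, hx, hw0]
    · obtain ⟨v, u, hv⟩ := exists_eq_pow_mul_unit hx
      rw [igusaIntegrand_of_pow_mul_unit f w hv]
      have hmem : ∀ d, x ∈ D d ↔ v < d := by
        intro d
        change ¬ _ ↔ _
        rw [hv, Units.dvd_mul_right, pow_dvd_pow_iff hp0 PadicInt.prime_p.not_isUnit, not_le]
      have h1 : HasSum (fun d => F d x) (q ^ (v + 1) * (1 - q)⁻¹) := by
        rw [← hasSum_nat_add_iff' (v + 1)]
        have h0 : ∑ i ∈ Finset.range (v + 1), F i x = 0 :=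
          Finset.sum_eq_zero fun i hi => Set.indicator_of_notMem (by
            rw [hmem]; have := Finset.mem_range.1 hi; omega) _
        rw [h0, sub_zero]
        refine ((hasSum_geometric_of_norm_lt_one hq1).mul_left (q ^ (v + 1))).congr_fun fun d => ?_
        simp only [F]
        rw [Set.indicator_of_mem (by rw [hmem]; omega), pow_add, mul_comm]
      rw [h1.tsum_eq, ← hq]
      ring
  have hmain := hasSum_integral_of_summable_integral_norm hFi (by
    simp only [hFnorm]
    exact summable_bounded_mul_pow (nonDivVolume_bound f) hq1)
  simp only [hFint, hpt] at hmain
  rw [integral_const_mul] at hmain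
  rw [hmain.tsum_eq, igusaZeta]
  field_simp

end Igusa

/-! ### Change of basis and equivalence of forms. -/

section CanonicalForm

variable {p : ℕ} [Fact p.Prime]
variable {L : Type*} [AddCommGroup L] [Module ℤ_[p] L]
variable {β : L →ₗ[ℤ_[p]] L →ₗ[ℤ_[p]] L}

theorem structureForm_isHomogeneous (β : L →ₗ[ℤ_[p]] L →ₗ[ℤ_[p]] L)
    (e : Module.Basis (Fin 3) ℤ_[p] L) : (structureForm β e).IsHomogeneous 2 := by
  have h : ∀ i j k, (structureLinearForm β e i j * MvPolynomial.X k).IsHomogeneous 2 := by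
    intro i j k
    refine MvPolynomial.IsHomogeneous.mul (m := 1) (n := 1) ?_ (MvPolynomial.isHomogeneous_X _ _)
    refine MvPolynomial.IsHomogeneous.sum _ _ _ fun l _ => ?_
    simpa using (MvPolynomial.isHomogeneous_C (Fin 3) _).mul (MvPolynomial.isHomogeneous_X _ l)
  exact ((h _ _ _).sub (h _ _ _)).add (h _ _ _)

theorem eval_matrixForm (A : Matrix (Fin 3) (Fin 3) ℤ_[p]) (x : Fin 3 → ℤ_[p]) :
    MvPolynomial.eval x (matrixForm A) = x ⬝ᵥ (A.mulVec x) := by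
  simp only [matrixForm, map_sum, map_mul, MvPolynomial.eval_C, MvPolynomial.eval_X,
    dotProduct, Matrix.mulVec, Finset.mul_sum]
  exact Finset.sum_congr rfl fun i _ => Finset.sum_congr rfl fun j _ => by ring

theorem exists_structureForm_eq_matrixForm (β : L →ₗ[ℤ_[p]] L →ₗ[ℤ_[p]] L)
    (e : Module.Basis (Fin 3) ℤ_[p] L) : ∃ A, structureForm β e = matrixForm A := by
  -- The columns are the coefficients of `L_{23}`, `-L_{13}`, `L_{12}`; leaving `A` unsymmetrised
  -- avoids division by `2`.
  refine ⟨Matrix.of fun k => ![structureConstant β e 1 2 k, -structureConstant β e 0 2 k,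
    structureConstant β e 0 1 k], ?_⟩
  simp only [structureForm, structureLinearForm, matrixForm, Fin.sum_univ_three, Matrix.of_apply,
    Matrix.cons_val, map_neg]
  ring

/-- The structure form transforms under a change of basis as prescribed by `FormEquivalent`. -/
theorem structureForm_basis_change (hβ : ∀ x y : L, β x y = -β y x)
    (e e' : Module.Basis (Fin 3) ℤ_[p] L) (A P : Matrix (Fin 3) (Fin 3) ℤ_[p])
    (hP : IsUnit P.det) (he : ∀ i, e' i = ∑ j, P j i • e j)
    (hA : structureForm β e = matrixForm A) :
    structureForm β e' = matrixForm (P.det • (P⁻¹ * A * (P⁻¹).transpose)) := by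
  have : Module.Free ℤ_[p] L := Module.Free.of_basis e
  refine MvPolynomial.funext fun x => ?_
  set w := (P⁻¹).transpose.mulVec x with hw
  have hφ : e'.constr ℤ_[p] x = e.constr ℤ_[p] w := by
    refine e'.ext fun i => ?_
    rw [Module.Basis.constr_basis, he, map_sum]
    simp only [map_smul, Module.Basis.constr_basis, smul_eq_mul]
    have h1 : P.transpose.mulVec w = x := by
      rw [hw, Matrix.mulVec_mulVec, ← Matrix.transpose_mul, Matrix.nonsing_inv_mul _ hP,
        Matrix.transpose_one, Matrix.one_mulVec]
    exact (congrFun h1 i).symm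
  rw [eval_structureForm, hφ, formValue_change hβ e e' P.transpose he, Matrix.det_transpose,
    ← eval_structureForm, hA, eval_matrixForm, eval_matrixForm, Matrix.smul_mulVec,
    dotProduct_smul, smul_eq_mul, ← Matrix.mulVec_mulVec, ← Matrix.mulVec_mulVec, ← hw,
    Matrix.dotProduct_mulVec x, ← Matrix.mulVec_transpose]

/-- Bases correspond to invertible matrices `P`, and the transformation rule holds for every matrix
`A` representing the form, so the ambiguity of `A` is harmless. -/
theorem exists_basis_iff_formEquivalent (hβ : ∀ x y : L, β x y = -β y x)
    (e : Module.Basis (Fin 3) ℤ_[p] L) (g : MvPolynomial (Fin 3) ℤ_[p]) :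
    (∃ e' : Module.Basis (Fin 3) ℤ_[p] L, structureForm β e' = g) ↔
      FormEquivalent (structureForm β e) g := by
  constructor
  · rintro ⟨e', rfl⟩
    obtain ⟨A, hA⟩ := exists_structureForm_eq_matrixForm β e
    have hP : IsUnit (e.toMatrix e').det := by
      rw [← Module.Basis.det_apply]
      exact e.isUnit_det e'
    exact ⟨A, e.toMatrix e', hP, hA, structureForm_basis_change hβ e e' A _ hP
      (fun i => (e.sum_toMatrix_smul_self e' i).symm) hA⟩
  · rintro ⟨A, P, hP, hA, rfl⟩
    refine ⟨e.map (Matrix.toLinearEquiv e P hP), structureForm_basis_change hβ e _ A P hP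
      (fun i => ?_) hA⟩
    rw [Module.Basis.map_apply]
    exact Matrix.toLin_self e e P i

end CanonicalForm

/-! ### Zeta functions as power series in `p^(-s)`, and reduction of `p^i L` to `L`. -/

section ZetaSeries

variable {p : ℕ} [Fact p.Prime]
variable {L : Type*} [AddCommGroup L] [Module ℤ_[p] L]

/-- The number of subalgebras of index `p^n`. -/
noncomputable def closedCount (β : L →ₗ[ℤ_[p]] L →ₗ[ℤ_[p]] L) (n : ℕ) : ℕ :=
  Nat.card {Λ : LatticeOfIndex p L (p ^ n) // ∀ x ∈ Λ.1, ∀ y ∈ Λ.1, β x y ∈ Λ.1}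

theorem relIndex_top_eq_latticeIndex (H : Submodule ℤ_[p] L) :
    H.toAddSubgroup.relIndex (⊤ : Submodule ℤ_[p] L).toAddSubgroup = latticeIndex H :=
  AddSubgroup.relIndex_top_right _

/-- Group the subalgebras by index; convergence follows by domination by the series counting all
lattices. -/
theorem subalgebraZeta_eq_tsum_closedCount [Module.Free ℤ_[p] L] [Module.Finite ℤ_[p] L]
    (hL : Module.finrank ℤ_[p] L = 3) (β : L →ₗ[ℤ_[p]] L →ₗ[ℤ_[p]] L) {s : ℂ}
    (ha : Summable fun n => ‖(latticeCount p 3 n : ℂ) * ((p : ℂ) ^ (-s)) ^ n‖) :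
    Summable (zetaTerm β ⊤ s) ∧
      subalgebraZeta β ⊤ s = ∑' n, (closedCount β n : ℂ) * ((p : ℂ) ^ (-s)) ^ n := by
  have hp : p.Prime := Fact.out
  have hex : ∀ H : FiniteIndexSubalgebra β (⊤ : Submodule ℤ_[p] L),
      ∃ n, latticeIndex H.1 = p ^ n := fun H =>
    exists_latticeIndex_eq_pow H.1 (by rw [← relIndex_top_eq_latticeIndex]; exact H.2.2.2)
  choose deg hdeg using hex
  have hterm : zetaTerm β ⊤ s = fun H => ((p : ℂ) ^ (-s)) ^ deg H := by
    funext H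
    rw [zetaTerm, relIndex_top_eq_latticeIndex, hdeg, natCast_pow_cpow]
  have e : ∀ n, Nonempty ({H // deg H = n} ≃
      {Λ : LatticeOfIndex p L (p ^ n) // ∀ x ∈ Λ.1, ∀ y ∈ Λ.1, β x y ∈ Λ.1}) := by
    intro n
    refine ⟨Equiv.ofBijective
      (fun H => ⟨⟨H.1.1, by rw [hdeg, H.2]⟩, H.1.2.2.1⟩) ⟨?_, ?_⟩⟩
    · intro H H' h
      exact Subtype.ext (Subtype.ext (congrArg (fun x => x.1.1) h))
    · rintro ⟨⟨Λ, hΛ⟩, hcl⟩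
      let H : FiniteIndexSubalgebra β (⊤ : Submodule ℤ_[p] L) := ⟨Λ, le_top, hcl, by
        rw [relIndex_top_eq_latticeIndex, hΛ]; exact pow_ne_zero _ hp.ne_zero⟩
      exact ⟨⟨H, Nat.pow_right_injective hp.two_le ((hdeg H).symm.trans hΛ)⟩, rfl⟩
  have hle : ∀ n, closedCount β n ≤ latticeCount p 3 n := by
    intro n
    rw [← hL, ← card_latticeOfIndex (p := p) (M := L) n]
    exact Finite.card_subtype_le _
  rw [subalgebraZeta, hterm]
  refine summable_pow_of_finite_fibers deg (closedCount β) _ (fun n => ?_) (fun n => ?_) ?_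
  · obtain ⟨e⟩ := e n
    exact Finite.of_equiv _ e.symm
  · obtain ⟨e⟩ := e n
    exact Nat.card_congr e
  · refine Summable.of_nonneg_of_le (fun _ => norm_nonneg _) (fun n => ?_) ha
    rw [norm_mul, norm_mul, Complex.norm_natCast, Complex.norm_natCast]
    exact mul_le_mul_of_nonneg_right (by exact_mod_cast hle n) (norm_nonneg _)

theorem closedCount_add [Module.Free ℤ_[p] L] [Module.Finite ℤ_[p] L]
    (hL : Module.finrank ℤ_[p] L = 3) (β : L →ₗ[ℤ_[p]] L →ₗ[ℤ_[p]] L) (n : ℕ) :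
    closedCount β n +
      Nat.card {Λ : LatticeOfIndex p L (p ^ n) // ¬ ∀ x ∈ Λ.1, ∀ y ∈ Λ.1, β x y ∈ Λ.1} =
      latticeCount p 3 n := by
  classical
  have := Fintype.ofFinite (LatticeOfIndex p L (p ^ n))
  rw [← hL, ← card_latticeOfIndex (p := p) (M := L) n, closedCount, Nat.card_eq_fintype_card,
    Nat.card_eq_fintype_card, Nat.card_eq_fintype_card]
  rw [← Fintype.card_sum]
  exact Fintype.card_congr (Equiv.sumCompl _)

/-- Subalgebras of `p^i L` correspond to the lattices in `L` closed under `p^i β`. -/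
theorem zeta_smul_top [Module.Free ℤ_[p] L] (β : L →ₗ[ℤ_[p]] L →ₗ[ℤ_[p]] L) (i : ℕ) (s : ℂ) :
    ∃ F : FiniteIndexSubalgebra ((p : ℤ_[p]) ^ i • β) (⊤ : Submodule ℤ_[p] L) ≃
      FiniteIndexSubalgebra β ((p : ℤ_[p]) ^ i • (⊤ : Submodule ℤ_[p] L)),
      ∀ K, zetaTerm β ((p : ℤ_[p]) ^ i • (⊤ : Submodule ℤ_[p] L)) s (F K) =
        zetaTerm ((p : ℤ_[p]) ^ i • β) ⊤ s K := by
  have hp0 : (p : ℤ_[p]) ^ i ≠ 0 :=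
    pow_ne_zero _ (by exact_mod_cast (Fact.out : p.Prime).ne_zero)
  let μ : L →ₗ[ℤ_[p]] L := LinearMap.lsmul ℤ_[p] L ((p : ℤ_[p]) ^ i)
  have hμ : ∀ x, μ x = (p : ℤ_[p]) ^ i • x := fun _ => rfl
  have hinj : Function.Injective μ := smul_right_injective L hp0
  have htop : (p : ℤ_[p]) ^ i • (⊤ : Submodule ℤ_[p] L) = (⊤ : Submodule ℤ_[p] L).map μ := rfl
  rw [htop]
  have hrel : ∀ K : Submodule ℤ_[p] L, (K.map μ).toAddSubgroup.relIndex
      ((⊤ : Submodule ℤ_[p] L).map μ).toAddSubgroup =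
      K.toAddSubgroup.relIndex (⊤ : Submodule ℤ_[p] L).toAddSubgroup := fun K =>
    AddSubgroup.relIndex_map_map_of_injective K.toAddSubgroup
      (⊤ : Submodule ℤ_[p] L).toAddSubgroup (f := μ.toAddMonoidHom) hinj
  have hcl : ∀ K : Submodule ℤ_[p] L, (∀ x ∈ K.map μ, ∀ y ∈ K.map μ, β x y ∈ K.map μ) ↔
      ∀ x ∈ K, ∀ y ∈ K, ((p : ℤ_[p]) ^ i • β) x y ∈ K := by
    intro K
    have key : ∀ a b, β (μ a) (μ b) ∈ K.map μ ↔ ((p : ℤ_[p]) ^ i • β) a b ∈ K := by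
      intro a b
      -- Of the two factors `p^i` one is absorbed by `μ` and the other by the product.
      have : β (μ a) (μ b) = μ (((p : ℤ_[p]) ^ i • β) a b) := by
        simp only [hμ, map_smul, LinearMap.smul_apply]
      rw [this]
      exact hinj.mem_set_image (s := (K : Set L))
    constructor
    · intro h a ha b hb
      exact (key a b).1 (h _ (Submodule.mem_map_of_mem ha) _ (Submodule.mem_map_of_mem hb))
    · rintro h _ ⟨a, ha, rfl⟩ _ ⟨b, hb, rfl⟩
      exact (key a b).2 (h a ha b hb)
  refine ⟨Equiv.ofBijective (fun K => ⟨K.1.map μ, Submodule.map_mono le_top,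
    (hcl K.1).2 K.2.2.1, by rw [hrel]; exact K.2.2.2⟩) ⟨?_, ?_⟩, ?_⟩
  · intro K K' h
    exact Subtype.ext (Submodule.map_injective_of_injective hinj (congrArg Subtype.val h))
  · rintro ⟨H, hle, hH, hidx⟩
    have hmap : (H.comap μ).map μ = H := by
      rw [Submodule.map_comap_eq, LinearMap.range_eq_map]
      exact inf_eq_right.2 hle
    refine ⟨⟨H.comap μ, le_top, (hcl _).1 (by rw [hmap]; exact hH), ?_⟩, Subtype.ext hmap⟩
    rw [← hrel, hmap]
    exact hidx
  · intro K
    change (((K.1.map μ).toAddSubgroup.relIndex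
      ((⊤ : Submodule ℤ_[p] L).map μ).toAddSubgroup : ℕ) : ℂ) ^ (-s) = _
    rw [hrel]
    rfl

end ZetaSeries

/-! ### Assembling the formula. -/

section MainFormula

variable {p : ℕ} [Fact p.Prime]
variable {L : Type*} [AddCommGroup L] [Module ℤ_[p] L]

theorem natCast_prime_ne_zero (p : ℕ) [Fact p.Prime] : (p : ℂ) ≠ 0 := by
  exact_mod_cast (Fact.out : p.Prime).ne_zero

theorem pow_mul_cpow (k : ℕ) (w : ℂ) : (p : ℂ) ^ k * (p : ℂ) ^ (-w) = (p : ℂ) ^ (-(w - k)) := by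
  rw [neg_sub, sub_eq_add_neg, Complex.cpow_add _ _ (natCast_prime_ne_zero p),
    Complex.cpow_natCast]

theorem one_sub_ne_zero_of_norm_lt_one {z : ℂ} (hz : ‖z‖ < 1) : 1 - z ≠ 0 := by
  rw [sub_ne_zero]
  rintro rfl
  rw [norm_one] at hz
  exact lt_irrefl _ hz

theorem one_sub_inv_natCast_prime_ne_zero (p : ℕ) [Fact p.Prime] : 1 - (p : ℂ)⁻¹ ≠ 0 := by
  have hp : p.Prime := Fact.out
  refine one_sub_ne_zero_of_norm_lt_one ?_
  rw [norm_inv, Complex.norm_natCast]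
  exact inv_lt_one_of_one_lt₀ (by exact_mod_cast hp.one_lt)

/-- The generating function of the lattices that are not subalgebras. -/
theorem hasSum_card_not_closed {β : L →ₗ[ℤ_[p]] L →ₗ[ℤ_[p]] L}
    (hβ : ∀ x y : L, β x y = -β y x) (e : Module.Basis (Fin 3) ℤ_[p] L) {t : ℂ}
    (hq : ‖(p : ℂ) ^ 2 * t‖ < 1) (hα : ∀ i < 3, ‖(p : ℂ) ^ i * (p * t ^ 2)‖ < 1) :
    HasSum (fun n => (Nat.card {Λ : LatticeOfIndex p L (p ^ n) //
        ¬ ∀ x ∈ Λ.1, ∀ y ∈ Λ.1, β x y ∈ Λ.1} : ℂ) * t ^ n)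
      ((1 - (p : ℂ)⁻¹)⁻¹ * (1 - (p : ℂ) ^ 2 * t ^ 2)⁻¹ *
        ∑' d, (nonDivVolume (structureForm β e) d : ℂ) * ((p : ℂ) ^ 2 * t) ^ d) := by
  have hp0 := natCast_prime_ne_zero p
  set q := (p : ℂ) ^ 2 * t with hqdef
  set Y : ℕ → ℂ := fun d => (nonDivVolume (structureForm β e) d : ℂ) with hY
  have hY0 : Y 0 = 0 := by simp [hY, nonDivVolume_zero]
  have hYs : Summable fun d => Y d * q ^ d :=
    (summable_bounded_mul_pow (nonDivVolume_bound _) hq).of_norm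
  set α : ℕ → ℂ := fun c => (latticeCount p 3 c : ℂ) * ((p : ℂ) ^ (3 * c))⁻¹ with hαdef
  set W : ℕ → ℂ := fun e => Y e - ((p : ℂ)⁻¹ + ((p : ℂ) ^ 3)⁻¹) * Y (e - 2) +
    ((p : ℂ) ^ 4)⁻¹ * Y (e - 4) with hW
  have hαq : ∀ c, α c * q ^ (2 * c) = (latticeCount p 3 c : ℂ) * ((p : ℂ) * t ^ 2) ^ c := by
    intro c
    have : q ^ 2 = (p : ℂ) ^ 3 * (p * t ^ 2) := by rw [hqdef]; ring
    simp only [hαdef]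
    rw [pow_mul q, this, mul_pow, ← pow_mul, mul_assoc, inv_mul_cancel_left₀ (pow_ne_zero _ hp0)]
  obtain ⟨hs, ht⟩ := summable_latticeCount (p := p) 3 ((p : ℂ) * t ^ 2) hα
  have hW0 : W 0 = 0 := by simp [hW, hY0]
  have hWsum : HasSum (fun e => W e * q ^ e) ((1 - (p : ℂ)⁻¹ * q ^ 2) *
      (1 - ((p : ℂ) ^ 3)⁻¹ * q ^ 2) * ∑' d, Y d * q ^ d) := by
    have h := (hYs.hasSum.sub ((hasSum_shift hY0 2 hYs).mul_left
      ((p : ℂ)⁻¹ + ((p : ℂ) ^ 3)⁻¹))).add ((hasSum_shift hY0 4 hYs).mul_left ((p : ℂ) ^ 4)⁻¹)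
    have hval : (1 - (p : ℂ)⁻¹ * q ^ 2) * (1 - ((p : ℂ) ^ 3)⁻¹ * q ^ 2) * ∑' d, Y d * q ^ d =
        ∑' d, Y d * q ^ d - ((p : ℂ)⁻¹ + ((p : ℂ) ^ 3)⁻¹) * (q ^ 2 * ∑' d, Y d * q ^ d) +
          ((p : ℂ) ^ 4)⁻¹ * (q ^ 4 * ∑' d, Y d * q ^ d) := by
      field_simp
      ring
    rw [hval]
    refine h.congr_fun fun e => ?_
    simp only [hW]
    ring
  have hWbound : ∀ e, ‖W e‖ ≤ 1 + ‖(p : ℂ)⁻¹ + ((p : ℂ) ^ 3)⁻¹‖ * 1 + ‖((p : ℂ) ^ 4)⁻¹‖ * 1 := by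
    intro e
    have hb : ∀ d, ‖Y d‖ ≤ 1 := nonDivVolume_bound _
    refine (norm_add_le _ _).trans (add_le_add ((norm_sub_le _ _).trans (add_le_add (hb _) ?_)) ?_)
    · rw [norm_mul]
      exact mul_le_mul_of_nonneg_left (hb _) (norm_nonneg _)
    · rw [norm_mul]
      exact mul_le_mul_of_nonneg_left (hb _) (norm_nonneg _)
  have hconv := hasSum_dilated_convolution (α := α) (W := W) (q := q) hW0
    (hs.congr fun c => by rw [hαq]) (summable_bounded_mul_pow hWbound hq)
  rw [tsum_congr hαq, ht, hWsum.tsum_eq] at hconv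
  have hcard : ∀ d, (∑ c ∈ Finset.range d, α c * W (d - 2 * c)) = (1 - (p : ℂ)⁻¹) *
      ((p : ℂ) ^ (2 * d))⁻¹ * (Nat.card {Λ : LatticeOfIndex p L (p ^ d) //
        ¬ ∀ x ∈ Λ.1, ∀ y ∈ Λ.1, β x y ∈ Λ.1} : ℂ) := by
    intro d
    have h := congrArg (fun r : ℝ => (r : ℂ)) (card_not_closed hβ e d)
    push_cast at h
    exact h.symm
  have hfinal := hconv.mul_left (1 - (p : ℂ)⁻¹)⁻¹
  have h1p := one_sub_inv_natCast_prime_ne_zero p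
  -- The factors `1 - p⁻¹ q²` and `1 - p⁻³ q²` equal `1 - p³ t²` and `1 - p t²`. They cancel the
  -- outer two Euler factors of the lattice count, leaving the middle one.
  have hval : (1 - (p : ℂ)⁻¹)⁻¹ * (1 - (p : ℂ) ^ 2 * t ^ 2)⁻¹ * (∑' d, Y d * q ^ d) =
      (1 - (p : ℂ)⁻¹)⁻¹ * ((∏ i ∈ Finset.range 3, (1 - (p : ℂ) ^ i * (p * t ^ 2))⁻¹) *
        ((1 - (p : ℂ)⁻¹ * q ^ 2) * (1 - ((p : ℂ) ^ 3)⁻¹ * q ^ 2) * ∑' d, Y d * q ^ d)) := by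
    have h0 := one_sub_ne_zero_of_norm_lt_one (hα 0 (by norm_num))
    have h1 := one_sub_ne_zero_of_norm_lt_one (hα 1 (by norm_num))
    have h2 := one_sub_ne_zero_of_norm_lt_one (hα 2 (by norm_num))
    have e1 : 1 - (p : ℂ)⁻¹ * q ^ 2 = 1 - (p : ℂ) ^ 2 * (p * t ^ 2) := by
      rw [hqdef]; field_simp
    have e2 : 1 - ((p : ℂ) ^ 3)⁻¹ * q ^ 2 = 1 - (p : ℂ) ^ 0 * (p * t ^ 2) := by
      rw [hqdef]; field_simp
    have e3 : 1 - (p : ℂ) ^ 2 * t ^ 2 = 1 - (p : ℂ) ^ 1 * (p * t ^ 2) := by ring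
    rw [e1, e2, e3, Finset.prod_range_succ, Finset.prod_range_succ, Finset.prod_range_one]
    generalize 1 - (p : ℂ) ^ 0 * (p * t ^ 2) = a at h0
    generalize 1 - (p : ℂ) ^ 1 * (p * t ^ 2) = b at h1
    generalize 1 - (p : ℂ) ^ 2 * (p * t ^ 2) = c at h2
    field_simp
  rw [hval]
  refine hfinal.congr_fun fun d => ?_
  rw [hcard, hqdef, mul_pow, ← pow_mul]
  generalize 1 - (p : ℂ)⁻¹ = a at h1p
  field_simp

theorem norm_pow_mul_cpow_lt_one {s : ℂ} (hs : 2 < s.re) (i : ℕ) (hi : i < 3) :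
    ‖(p : ℂ) ^ i * (p : ℂ) ^ (-s)‖ < 1 := by
  rw [pow_mul_cpow]
  refine norm_cpow_neg_lt_one ?_
  have : (i : ℝ) ≤ 2 := by exact_mod_cast (by omega : i ≤ 2)
  simp only [Complex.sub_re, Complex.natCast_re]
  linarith

theorem norm_pow_mul_sq_cpow_lt_one {s : ℂ} (hs : 2 < s.re) (i : ℕ) (hi : i < 3) :
    ‖(p : ℂ) ^ i * (p * ((p : ℂ) ^ (-s)) ^ 2)‖ < 1 := by
  have h : (p : ℂ) ^ i * (p * ((p : ℂ) ^ (-s)) ^ 2) =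
      ((p : ℂ) ^ i * (p : ℂ) ^ (-s)) * ((p : ℂ) ^ 1 * (p : ℂ) ^ (-s)) := by ring
  rw [h, norm_mul]
  exact mul_lt_one_of_nonneg_of_lt_one_left (norm_nonneg _) (norm_pow_mul_cpow_lt_one hs i hi)
    (norm_pow_mul_cpow_lt_one hs 1 (by norm_num)).le

theorem localZeta_eq_pow (s : ℂ) (k : ℕ) :
    localZeta p (s - k) = (1 - (p : ℂ) ^ k * (p : ℂ) ^ (-s))⁻¹ := by
  rw [localZeta, pow_mul_cpow]

theorem tsum_latticeCount_three {s : ℂ} (hs : 2 < s.re) :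
    ∑' n, (latticeCount p 3 n : ℂ) * ((p : ℂ) ^ (-s)) ^ n =
      localZeta p s * localZeta p (s - 1) * localZeta p (s - 2) := by
  rw [(summable_latticeCount 3 _ (norm_pow_mul_cpow_lt_one hs)).2, Finset.prod_range_succ,
    Finset.prod_range_succ, Finset.prod_range_one]
  have h0 := localZeta_eq_pow (p := p) s 0
  have h1 := localZeta_eq_pow (p := p) s 1
  have h2 := localZeta_eq_pow (p := p) s 2
  rw [Nat.cast_zero, sub_zero] at h0
  rw [Nat.cast_one] at h1
  rw [Nat.cast_ofNat] at h2
  rw [h0, h1, h2]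

theorem subalgebraZeta_abelian {s : ℂ} (hs : 2 < s.re) :
    Summable (zetaTerm (abelianBracket p) ⊤ s) ∧
      subalgebraZeta (abelianBracket p) ⊤ s =
        localZeta p s * localZeta p (s - 1) * localZeta p (s - 2) := by
  have hr : Module.finrank ℤ_[p] (Fin 3 → ℤ_[p]) = 3 := by simp
  obtain ⟨h1, h2⟩ := subalgebraZeta_eq_tsum_closedCount hr (abelianBracket p)
    (summable_latticeCount 3 _ (norm_pow_mul_cpow_lt_one (p := p) hs)).1
  refine ⟨h1, ?_⟩
  rw [h2, ← tsum_latticeCount_three hs]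
  refine tsum_congr fun n => ?_
  have hadd := closedCount_add hr (abelianBracket p) n
  have : IsEmpty {Λ : LatticeOfIndex p (Fin 3 → ℤ_[p]) (p ^ n) //
      ¬ ∀ x ∈ Λ.1, ∀ y ∈ Λ.1, abelianBracket p x y ∈ Λ.1} :=
    ⟨fun Λ => Λ.2 fun _ _ _ _ => Λ.1.1.zero_mem⟩
  rw [Nat.card_of_isEmpty, add_zero] at hadd
  rw [hadd]

/-- The subalgebra zeta function of `L` in terms of Igusa's zeta function of the structure form. -/
theorem subalgebraZeta_top {β : L →ₗ[ℤ_[p]] L →ₗ[ℤ_[p]] L}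
    (hβ : ∀ x y : L, β x y = -β y x) (e : Module.Basis (Fin 3) ℤ_[p] L) {s : ℂ}
    (hs : 2 < s.re) :
    Summable (zetaTerm β ⊤ s) ∧
      subalgebraZeta β ⊤ s = subalgebraZeta (abelianBracket p) ⊤ s -
        igusaZeta (structureForm β e) (s - 2) * localZeta p (2 * s - 2) * localZeta p (s - 2) *
          (p : ℂ) ^ (2 - s) * (1 - (p : ℂ)⁻¹)⁻¹ := by
  have : Module.Free ℤ_[p] L := Module.Free.of_basis e
  have : Module.Finite ℤ_[p] L := Module.Finite.of_basis e
  have hr : Module.finrank ℤ_[p] L = 3 := by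
    rw [Module.finrank_eq_card_basis e, Fintype.card_fin]
  have hA := (summable_latticeCount 3 _ (norm_pow_mul_cpow_lt_one (p := p) hs)).1
  obtain ⟨h1, h2⟩ := subalgebraZeta_eq_tsum_closedCount hr β hA
  refine ⟨h1, ?_⟩
  set t := (p : ℂ) ^ (-s) with ht
  have hN := hasSum_card_not_closed hβ e (t := t) (norm_pow_mul_cpow_lt_one hs 2 (by norm_num))
    (norm_pow_mul_sq_cpow_lt_one hs)
  have hsub := hA.of_norm.hasSum.sub hN
  have hclosed : ∀ n, (closedCount β n : ℂ) * t ^ n = (latticeCount p 3 n : ℂ) * t ^ n -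
      (Nat.card {Λ : LatticeOfIndex p L (p ^ n) //
        ¬ ∀ x ∈ Λ.1, ∀ y ∈ Λ.1, β x y ∈ Λ.1} : ℂ) * t ^ n := by
    intro n
    rw [← closedCount_add hr β n, Nat.cast_add]
    ring
  rw [h2, (hsub.congr_fun hclosed).tsum_eq, (subalgebraZeta_abelian hs).2,
    tsum_latticeCount_three hs]
  congr 1
  have hq : (p : ℂ) ^ 2 * t = (p : ℂ) ^ (-(s - 2)) := by
    rw [ht, pow_mul_cpow, Nat.cast_ofNat]
  have hI := mul_igusaZeta (structureForm β e) (w := s - 2) (by simpa using hs)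
  have hz2 : localZeta p (s - 2) = (1 - (p : ℂ) ^ (-(s - 2)))⁻¹ := rfl
  have hz : localZeta p (2 * s - 2) = (1 - (p : ℂ) ^ 2 * t ^ 2)⁻¹ := by
    have := localZeta_eq_pow (p := p) (2 * s) 2
    rw [Nat.cast_ofNat] at this
    rw [this, ht, ← Complex.cpow_nat_mul, Nat.cast_ofNat, mul_neg]
  have hne : 1 - (p : ℂ) ^ (-(s - 2)) ≠ 0 :=
    one_sub_ne_zero_of_norm_lt_one (norm_cpow_neg_lt_one (by simpa using hs))
  rw [hz2, hz, show (2 - s) = -(s - 2) by ring, hq]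
  have hsum := (eq_div_iff hne).2 ((mul_comm _ _).trans hI.symm)
  rw [hsum]
  field_simp

theorem structureForm_smul (β : L →ₗ[ℤ_[p]] L →ₗ[ℤ_[p]] L) (e : Module.Basis (Fin 3) ℤ_[p] L)
    (a : ℤ_[p]) (x : Fin 3 → ℤ_[p]) :
    MvPolynomial.eval x (structureForm (a • β) e) =
      a * MvPolynomial.eval x (structureForm β e) := by
  simp only [eval_structureForm, formValue, LinearMap.smul_apply, map_smul, smul_eq_mul]
  ring

theorem igusaZeta_structureForm_smul (β : L →ₗ[ℤ_[p]] L →ₗ[ℤ_[p]] L)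
    (e : Module.Basis (Fin 3) ℤ_[p] L) (i : ℕ) (w : ℂ) :
    igusaZeta (structureForm ((p : ℤ_[p]) ^ i • β) e) w =
      ((p : ℂ) ^ (-w)) ^ i * igusaZeta (structureForm β e) w := by
  rw [igusaZeta, igusaZeta, ← integral_const_mul]
  refine integral_congr_ae (Filter.Eventually.of_forall fun x => ?_)
  simp only [igusaIntegrand]
  rw [structureForm_smul, norm_mul, Complex.ofReal_mul,
    Complex.mul_cpow_ofReal_nonneg (norm_nonneg _) (norm_nonneg _), norm_pow, PadicInt.norm_p,
    ofReal_pow_cpow (by positivity), Complex.cpow_neg, Complex.ofReal_inv, Complex.ofReal_natCast,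
    Complex.inv_cpow _ _ (by rw [Complex.natCast_arg]; exact Real.pi_pos.ne)]

end MainFormula

end PadicLieZeta

theorem theorem1 (p : ℕ) [Fact p.Prime] {L : Type*} [AddCommGroup L] [Module ℤ_[p] L]
    [Module.Free ℤ_[p] L] (hL : Module.finrank ℤ_[p] L = 3)
    (β : L →ₗ[ℤ_[p]] L →ₗ[ℤ_[p]] L) (hβ : ∀ x y : L, β x y = -β y x) :
    ∃ f : MvPolynomial (Fin 3) ℤ_[p],
      f.IsHomogeneous 2 ∧
      (∀ g : MvPolynomial (Fin 3) ℤ_[p],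
        (∃ e : Module.Basis (Fin 3) ℤ_[p] L, PadicLieZeta.structureForm β e = g) ↔
          PadicLieZeta.FormEquivalent f g) ∧
      ∀ (i : ℕ) (s : ℂ), 2 < s.re →
        Summable (PadicLieZeta.zetaTerm β ((p : ℤ_[p]) ^ i • (⊤ : Submodule ℤ_[p] L)) s) ∧
        Summable (PadicLieZeta.zetaTerm (PadicLieZeta.abelianBracket p) ⊤ s) ∧
        MeasureTheory.Integrable (PadicLieZeta.igusaIntegrand f (s - 2)) ∧
        PadicLieZeta.subalgebraZeta (PadicLieZeta.abelianBracket p) ⊤ s =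
          PadicLieZeta.localZeta p s * PadicLieZeta.localZeta p (s - 1) *
            PadicLieZeta.localZeta p (s - 2) ∧
        PadicLieZeta.subalgebraZeta β ((p : ℤ_[p]) ^ i • (⊤ : Submodule ℤ_[p] L)) s =
          PadicLieZeta.subalgebraZeta (PadicLieZeta.abelianBracket p) ⊤ s -
            PadicLieZeta.igusaZeta f (s - 2) * PadicLieZeta.localZeta p (2 * s - 2) *
              PadicLieZeta.localZeta p (s - 2) * (p : ℂ) ^ ((2 - s) * ((i : ℂ) + 1)) *
              (1 - (p : ℂ)⁻¹)⁻¹ := by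
  have : Module.Finite ℤ_[p] L := Module.finite_of_finrank_pos (by omega)
  let e := Module.finBasisOfFinrankEq ℤ_[p] L hL
  refine ⟨PadicLieZeta.structureForm β e, PadicLieZeta.structureForm_isHomogeneous β e,
    PadicLieZeta.exists_basis_iff_formEquivalent hβ e, fun i s hs => ?_⟩
  obtain ⟨F, hF⟩ := PadicLieZeta.zeta_smul_top β i s
  have hβi : ∀ x y : L, ((p : ℤ_[p]) ^ i • β) x y = -((p : ℤ_[p]) ^ i • β) y x := by
    intro x y
    rw [LinearMap.smul_apply, LinearMap.smul_apply, LinearMap.smul_apply, LinearMap.smul_apply,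
      hβ x y, smul_neg]
  obtain ⟨hsum, hzeta⟩ := PadicLieZeta.subalgebraZeta_top hβi e hs
  refine ⟨?_, (PadicLieZeta.subalgebraZeta_abelian hs).1,
    PadicLieZeta.integrable_igusaIntegrand _ (by simpa using hs),
    (PadicLieZeta.subalgebraZeta_abelian hs).2, ?_⟩
  · rw [← F.summable_iff]
    exact hsum.congr fun K => (hF K).symm
  -- The `i`-fold factor comes from scaling `f` by `p^i`, the remaining one from the formula for a
  -- single algebra.
  · have hexp : (p : ℂ) ^ ((2 - s) * ((i : ℂ) + 1)) =
        ((p : ℂ) ^ (-(s - 2))) ^ i * (p : ℂ) ^ (2 - s) := by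
      rw [mul_add, mul_one, Complex.cpow_add _ _ (PadicLieZeta.natCast_prime_ne_zero p),
        Complex.cpow_mul_nat, neg_sub]
    rw [PadicLieZeta.subalgebraZeta, ← F.tsum_eq, tsum_congr hF]
    refine hzeta.trans ?_
    rw [PadicLieZeta.igusaZeta_structureForm_smul, hexp]
    ring
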